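/- Let $\mathbb F_q$ be a finite field of characteristic different from $2$, and let $n\ge 1$ be an integer. All geometric objects (intersection points, tangent lines, torsion points) are taken over $\overline{\mathbb F}_q$. An ordered pair $(\mathcal A,\mathcal B)$ of smooth plane conics over $\mathbb F_q$ meeting transversally (in four distinct points) satisfies the Poncelet $n$-gon condition if $j^n(P,\xi)=(P,\xi)$ for some $(P,\xi)$ in the curve of pairs consisting of a point $P\in\mathcal A$ and a tangent line $\xi$ of $\mathcal B$ with $P\in\xi$; here $j(P,\xi)=(P',\xi')$, where $P'$ is the second point of $\xi\cap\mathcal A$ (equal to $P$ if $\xi$ is tangent to $\mathcal A$) and $\xi'$ is the second tangent line to $\mathcal B$ through $P'$ (equal to $\xi$ if there is only one). Let $\mathcal P$ be a pencil of conics over $\mathbb F_q$ (all $\mathbb F_q$-combinations $\eta_1F+\eta_2G$, $(\eta_1:\eta_2)\in\mathbb P^1(\mathbb F_q)$, of two distinct conics $F,G$) whose base locus consists of four distinct points. Its intersection type is the cycle type of the $q$-power Frobenius on these four points. Let $n^{\mathcal P}$ be the number of ordered pairs of smooth members of $\mathcal P$, meeting transversally, that satisfy the Poncelet $n$-gon condition.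 For an elliptic curve $E:y^2=f(x)$, $f$ a monic cubic, put $$N_n(E)=\bigl|\{P\in E[n]\setminus E[2] : x(P)\in\mathbb F_q\}\bigr|,\qquad E[n]\subset E(\overline{\mathbb F}_q).$$ 1. If $\mathcal P$ has type $(1,1,1,1)$ or $(2,2)$, then $$n^{\mathcal P}=\frac12\sum_{\lambda_0\in\mathbb F_q\setminus\{0,1\}}N_n\bigl(y^2=x(x-1)(x-\lambda_0)\bigr).$$ 2. If $\mathcal P$ has type $(2,1,1)$ or $(4)$, then for every non-square $b\in\mathbb F_q$ $$n^{\mathcal P}=\frac12\sum_{\lambda_0\in\mathbb F_q}N_n\bigl(y^2=(x-\lambda_0)(x^2-b)\bigr).$$ 3. If $\mathcal P$ has type $(3,1)$, then for every $\alpha\in\mathbb F_{q^3}\setminus\mathbb F_q$, with conjugates $\alpha_i=\alpha^{q^i}$, $i=0,1,2$, $$n^{\mathcal P}=\frac12\sum_{\lambda_0\in\mathbb P^1(\mathbb F_q)}N_n(E_{\lambda_0}),$$ where $E_{\lambda_0}:y^2=\prod_{i=0}^{2}\Bigl(x-\frac{\alpha_i}{\alpha_i+\lambda_0}\Bigr)$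 for $\lambda_0\in\mathbb F_q\setminus\{0\}$, $E_0:y^2=\prod_{i=0}^{2}(x-\alpha_i^{-1})$ and $E_\infty:y^2=\prod_{i=0}^{2}(x-\alpha_i)$. -/

import Mathlib

open scoped LinearAlgebra.Projectivization

noncomputable section

namespace Poncelet

universe u v

/-- The symmetric `3 × 3` matrices over `F`. -/
def symMatrices (F : Type u) [Field F] : Submodule F (Matrix (Fin 3) (Fin 3) F) where
  carrier := {M | M.IsSymm}
  add_mem' h₁ h₂ := h₁.add h₂
  zero_mem' := Matrix.isSymm_zero
  smul_mem' c _ h := h.smul c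

/-- A projective plane conic over a field `F` of characteristic different from `2`:
a nonzero symmetric matrix `M` up to scaling, standing for the equation `vᵀ M v = 0`. -/
abbrev Conic (F : Type u) [Field F] := ℙ F (symMatrices F)

/-- The projective plane over `K`. -/
abbrev Plane (K : Type v) [Field K] := ℙ K (Fin 3 → K)

/-- The lines of the projective plane over `K`, given by their coefficient vectors:
`ξ` stands for the line `{X | ξ₀ X₀ + ξ₁ X₁ + ξ₂ X₂ = 0}`. -/
abbrev DualPlane (K : Type v) [Field K] := ℙ K (Fin 3 → K)

/-- Incidence of a point and a line. -/
def OnLine {K : Type v} [Field K] (X : Plane K) (ξ : DualPlane K) : Prop :=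
  ξ.rep ⬝ᵥ X.rep = 0

section Conics

variable {F : Type u} [Field F] (K : Type v) [Field K] [Algebra F K]

/-- A matrix representing the conic `C`, with its entries read in the extension field `K`. -/
def Conic.mat (C : Conic F) : Matrix (Fin 3) (Fin 3) K :=
  (C.rep : Matrix (Fin 3) (Fin 3) F).map (algebraMap F K)

/-- The `K`-points of the conic `C`. -/
def Conic.points (C : Conic F) : Set (Plane K) :=
  {X | X.rep ⬝ᵥ (C.mat K).mulVec X.rep = 0}

/-- The conic `C` has no singular `K`-point; the gradient of `vᵀ M v` is `2 M v`.
Used with `K` an algebraic closure of `F`. -/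
def Conic.IsSmooth (C : Conic F) : Prop :=
  ∀ X ∈ C.points K, (C.mat K).mulVec X.rep ≠ 0

/-- The dual conic of a (smooth) conic `C`, that is, the set of its tangent lines.
The tangent line at the point `v` has coefficient vector `M v`. -/
def Conic.tangents (C : Conic F) : Set (DualPlane K) :=
  {ξ | ∃ X ∈ C.points K, ∃ c : K, ξ.rep = c • (C.mat K).mulVec X.rep}

/-- Two conics intersect transversally: they meet in four distinct points.
Used with `K` an algebraic closure of `F`. -/
def Transversal (A B : Conic F) : Prop :=
  (A.points K ∩ B.points K).ncard = 4

/-- The incidence curve `E ⊆ A × B*` of pairs `(P, ξ)` of a point `P` of `A` and a line `ξ` tangent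
to `B` with `P ∈ ξ`. -/
def incidenceCurve (A B : Conic F) : Set (Plane K × DualPlane K) :=
  {e | e.1 ∈ A.points K ∧ e.2 ∈ B.tangents K ∧ OnLine e.1 e.2}

/-- The graph of the Poncelet map `j : (P, ξ) ↦ (P', ξ')`: the points of `A` on `ξ` are `P` and `P'`
(with `P' = P` if there is only one), and the tangents of `B` through `P'` are `ξ` and `ξ'`
(with `ξ' = ξ` if there is only one). -/
def PonceletStep (A B : Conic F) (e e' : Plane K × DualPlane K) : Prop :=
  {X | X ∈ A.points K ∧ OnLine X e.2} = {e.1, e'.1} ∧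
  {ξ | ξ ∈ B.tangents K ∧ OnLine e'.1 ξ} = {e.2, e'.2}

/-- `(A, B)` satisfies the Poncelet `n`-gon condition: `j^n (P, ξ) = (P, ξ)` for some `(P, ξ) ∈ E`.
Used with `K` an algebraic closure of `F`. -/
def PonceletCondition (n : ℕ) (A B : Conic F) : Prop :=
  ∃ s : ℕ → Plane K × DualPlane K, s 0 ∈ incidenceCurve K A B ∧
    (∀ i, PonceletStep K A B (s i) (s (i + 1))) ∧ s n = s 0

end Conics

/-- A pencil of conics over `F`: a two-dimensional space of symmetric matrices, whose members are
the conics `η₁ M₁ + η₂ M₂ = 0` spanned by two distinct conics `M₁`, `M₂`. -/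
structure Pencil (F : Type u) [Field F] where
  space : Submodule F (symMatrices F)
  finrank_eq : Module.finrank F space = 2

/-- The conics (over `F`) that belong to a pencil. -/
def Pencil.members {F : Type u} [Field F] (P : Pencil F) : Set (Conic F) :=
  {C | C.rep ∈ P.space}

/-- The `K`-points common to all conics of a pencil. -/
def Pencil.basePoints {F : Type u} [Field F] (K : Type v) [Field K] [Algebra F K]
    (P : Pencil F) : Set (Plane K) :=
  {X | ∀ C ∈ P.members, X ∈ C.points K}

/-- The action of the `q`-power Frobenius on the projective plane, `q = |F|`. -/
def frobPoint (F : Type u) [Fintype F] {K : Type v} [Field K] (X : Plane K) : Plane K :=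
  Projectivization.mk K (fun i => X.rep i ^ Fintype.card F) (by
    intro h
    apply X.rep_nonzero
    funext i
    exact eq_zero_of_pow_eq_zero (congrFun h i))

/-- The pencil has intersection type `μ` (a partition of `4`): its base locus over `K`
consists of four distinct points, and the `q`-power Frobenius permutes them with cycle
lengths `μ` (fixed points counted as cycles of length `1`).
Used with `K` an algebraic closure of `F`. -/
def Pencil.HasType {F : Type u} [Field F] [Fintype F] (K : Type v) [Field K] [Algebra F K]
    (P : Pencil F) (μ : Multiset ℕ) : Prop :=
  ∃ (p : Fin 4 → Plane K) (σ : Equiv.Perm (Fin 4)),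
    Function.Injective p ∧ P.basePoints K = Set.range p ∧
    (∀ i, frobPoint F (p i) = p (σ i)) ∧ σ.partition.parts = μ

/-- The ordered pairs of smooth conics of the pencil that intersect transversally and satisfy the
Poncelet `n`-gon condition. -/
def Pencil.ponceletPairs {F : Type u} [Field F] (K : Type v) [Field K] [Algebra F K]
    (P : Pencil F) (n : ℕ) : Set (Conic F × Conic F) :=
  {c | c.1 ∈ P.members ∧ c.2 ∈ P.members ∧ c.1.IsSmooth K ∧ c.2.IsSmooth K ∧
    Transversal K c.1 c.2 ∧ PonceletCondition K n c.1 c.2}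

/-- The Weierstrass curve `y² = f(x)`, for a monic cubic polynomial `f`. -/
def cubicCurve {K : Type v} [Field K] (f : Polynomial K) : WeierstrassCurve K where
  a₁ := 0
  a₂ := f.coeff 2
  a₃ := 0
  a₄ := f.coeff 1
  a₆ := f.coeff 0

/-- For `y² = f(x)` over `K`, the set of points `P ∈ E[n] ∖ E[2]` over `K` with `x(P) ∈ F`. -/
def torsionPoints (F : Type u) [Field F] {K : Type v} [Field K] [DecidableEq K] [Algebra F K]
    (n : ℕ) (f : Polynomial K) : Set (cubicCurve f).toAffine.Point :=
  {P | n • P = 0 ∧ 2 • P ≠ 0 ∧ ∃ (x : F) (y : K)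
    (h : (cubicCurve f).toAffine.Nonsingular (algebraMap F K x) y), P = .some _ y h}

/-- The number of points `P ∈ E[n] ∖ E[2]` over `K` with `x(P) ∈ F`, for `E : y² = f(x)`. -/
def torsionCount (F : Type u) [Field F] {K : Type v} [Field K] [DecidableEq K] [Algebra F K]
    (n : ℕ) (f : Polynomial K) : ℕ :=
  (torsionPoints F n f).ncard

end Poncelet

end

/-! Let `M` be a smooth member of the pencil and `N` a second one, so that every member other than
`M` is `N + c • M` for a unique `c`. Parametrize the conic `M` by the projective line so that the
base points have parameters `∞, e 0, e 1, e 2`; after normalization, the members `N + e i • M` are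
exactly the degenerate ones. The chord of `M` with parameters `s`, `t` is tangent to `N + c • M`
precisely when a symmetric biquadratic form `corr` in `s`, `t` vanishes. The same form says that
`s`, `t`, `c` are the abscissas of three collinear points of `E : y² = ∏ (x - e i)`. Hence, for a
point `Q` of `E` with abscissa `c`, the incidence curve is a copy of `E` on which the Poncelet map
is translation by `Q`, and it closes after `n` steps if and only if `n • Q = 0` (`corr_eq_zero_iff`,
`chordVec_adjugate_pencilMat`, `ponceletCondition_iff`).

The partners of `M` therefore correspond to the abscissas in `F` of `E[n] ∖ E[2]`, smoothness of the
partner being the exclusion of `E[2]`. Each abscissa belongs to the two points `±Q`, whence the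
factor `1/2` (`ncard_partners`, `torsionCount_eq`). Summing over the smooth members `M` gives
`ncard_ponceletPairs`.

What remains is to list the smooth members with their curves. Degenerate members correspond to
splittings of the four base points into two pairs, so Frobenius acts on them through the map from
`S₄` to `S₃`. The image is trivial for types (1,1,1,1) and (2,2), a transposition for (2,1,1) and
(4), and a 3-cycle for (3,1). In each case rational coordinates on the pencil turn the curves into
the stated family (`ncard_of_trivial`, `ncard_of_swap`, `ncard_of_rotate`). -/

noncomputable section

namespace Poncelet

/-! ### Translation on `y² = f(x)` as a correspondence between abscissas. -/

section GroupLaw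

open WeierstrassCurve.Affine

variable {K : Type*} [Field K]

/-- The `x`-coordinate of a point of an affine Weierstrass curve, with `none` for infinity. -/
def xCoord {W : WeierstrassCurve.Affine K} : W.Point → Option K
  | .zero => none
  | .some x _ _ => some x

/-- The symmetric biquadratic form in `s`, `t` which vanishes if and only if `s`, `t` and `c` are
the `x`-coordinates of three collinear points of `y² = f(x)`. -/
def corr (f : Polynomial K) (c : K) : Option K → Option K → K
  | none, none => 1
  | none, some t => (t - c) ^ 2
  | some s, none => (s - c) ^ 2
  -- If the line `y = λx + μ` meets the curve above `s`, `t`, `c`, comparing coefficients gives `λ²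
  -- = s + t + c + f₂`, `2λμ = f₁ - (st + sc + tc)` and `μ² = stc + f₀`. The form is `(2λμ)² -
  -- 4λ²μ²`; the cases with `none` are its leading coefficients in `s` and `t`.
  | some s, some t => (f.coeff 1 - (s * t + s * c + t * c)) ^ 2 -
      4 * (s + t + c + f.coeff 2) * (s * t * c + f.coeff 0)

/-- The value at `x` of the monic cubic with the coefficients of `f` in degrees `< 3`. -/
def cubicEval (f : Polynomial K) (x : K) : K :=
  x ^ 3 + f.coeff 2 * x ^ 2 + f.coeff 1 * x + f.coeff 0

lemma equation_cubicCurve {f : Polynomial K} {x y : K} :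
    (cubicCurve f).toAffine.Equation x y ↔ y ^ 2 = cubicEval f x := by
  rw [WeierstrassCurve.Affine.equation_iff]
  simp [cubicCurve, cubicEval]

lemma nonsingular_cubicCurve_of_ne_zero (h2 : (2 : K) ≠ 0) {f : Polynomial K} {x y : K}
    (h : y ^ 2 = cubicEval f x) (hy : y ≠ 0) : (cubicCurve f).toAffine.Nonsingular x y := by
  rw [WeierstrassCurve.Affine.nonsingular_iff]
  refine ⟨equation_cubicCurve.2 h, Or.inr ?_⟩
  simp only [cubicCurve]
  intro h'
  apply hy
  have : 2 * y = 0 := by linear_combination h'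
  simpa [h2] using this

lemma negY_cubicCurve (f : Polynomial K) (x y : K) : (cubicCurve f).toAffine.negY x y = -y := by
  simp [WeierstrassCurve.Affine.negY, cubicCurve]

lemma xCoord_neg {f : Polynomial K} (R : (cubicCurve f).toAffine.Point) :
    xCoord (-R) = xCoord R := by
  cases R <;> rfl

lemma eq_or_eq_neg_of_xCoord_eq {f : Polynomial K} {R S : (cubicCurve f).toAffine.Point}
    (h : xCoord R = xCoord S) : R = S ∨ R = -S := by
  rcases R with _ | ⟨x, y, hR⟩ <;> rcases S with _ | ⟨x', y', hS⟩ <;> simp only [xCoord] at h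
  · exact Or.inl rfl
  · cases h
  · cases h
  · obtain rfl : x = x' := Option.some.inj h
    have h₁ := equation_cubicCurve.1 hR.1
    have h₂ := equation_cubicCurve.1 hS.1
    rcases sq_eq_sq_iff_eq_or_eq_neg.1 (h₁.trans h₂.symm) with rfl | h
    · exact Or.inl rfl
    · right
      rw [Point.neg_some, Point.some.injEq]
      exact ⟨rfl, by rw [negY_cubicCurve, h]⟩

variable [DecidableEq K]

lemma xCoord_add_of_ne {f : Polynomial K} {x y c d : K}
    (h : (cubicCurve f).toAffine.Nonsingular x y) (h' : (cubicCurve f).toAffine.Nonsingular c d)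
    (hx : x ≠ c) :
    xCoord (Point.some x y h + Point.some c d h') =
      some (((y - d) / (x - c)) ^ 2 - f.coeff 2 - x - c) := by
  rw [Point.add_of_X_ne hx]
  simp only [xCoord, WeierstrassCurve.Affine.addX, WeierstrassCurve.Affine.slope_of_X_ne hx]
  simp [cubicCurve]

lemma xCoord_add_self {f : Polynomial K} (h2 : (2 : K) ≠ 0) {x y : K}
    (h : (cubicCurve f).toAffine.Nonsingular x y) (hy : y ≠ 0) :
    xCoord (Point.some x y h + Point.some x y h) =
      some (((3 * x ^ 2 + 2 * f.coeff 2 * x + f.coeff 1) / (2 * y)) ^ 2 - f.coeff 2 - x - x) := by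
  have hy' : y ≠ (cubicCurve f).toAffine.negY x y := by
    rw [negY_cubicCurve]
    intro h'
    have : 2 * y = 0 := by linear_combination h'
    simp [h2, hy] at this
  rw [Point.add_self_of_Y_ne hy']
  simp only [xCoord, WeierstrassCurve.Affine.addX, WeierstrassCurve.Affine.slope_of_Y_ne rfl hy',
    negY_cubicCurve]
  simp only [cubicCurve]
  congr 1
  ring

/-- The correspondence `corr f c` relates `x(R)` with `x(R + Q)` and `x(R - Q)` exactly, for a
point `Q` with `x`-coordinate `c`. -/
theorem corr_eq_zero_iff {f : Polynomial K} (h2 : (2 : K) ≠ 0) {c d : K} (hd : d ≠ 0)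
    (hQ : (cubicCurve f).toAffine.Nonsingular c d) (R : (cubicCurve f).toAffine.Point)
    (t : Option K) :
    corr f c (xCoord R) t = 0 ↔
      t = xCoord (R + Point.some c d hQ) ∨ t = xCoord (R - Point.some c d hQ) := by
  have hQe := equation_cubicCurve.1 hQ.1
  rcases R with _ | ⟨x, y, hR⟩
  · change corr f c none t = 0 ↔ t = xCoord (0 + _) ∨ t = xCoord (0 - _)
    rw [zero_add, zero_sub, xCoord_neg, or_self]
    cases t with
    | none => simp [corr, xCoord]
    | some t => simp [corr, xCoord, sub_eq_zero]
  · have hRe := equation_cubicCurve.1 hR.1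
    by_cases hx : x = c
    · subst hx
      -- Here `R = ±Q`, so one of `R ± Q` is the point at infinity and the other is `±2Q`. The form
      -- drops to degree one in `t`.
      have key : t = xCoord (Point.some x d hQ + Point.some x d hQ) ∨ t = none ↔
          corr f x (xCoord (Point.some x y hR)) t = 0 := by
        rw [xCoord_add_self h2 hQ hd]
        have hf : cubicEval f x ≠ 0 := by rw [← hQe]; exact pow_ne_zero _ hd
        cases t with
        | none => simp [xCoord, corr]
        | some t =>
          have h4 : (4 : K) ≠ 0 := by
            rw [show (4 : K) = 2 * 2 by norm_num]; exact mul_ne_zero h2 h2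
          simp only [xCoord, corr, reduceCtorEq, or_false, Option.some.injEq]
          have e : (f.coeff 1 - (x * t + x * x + t * x)) ^ 2 -
              4 * (x + t + x + f.coeff 2) * (x * t * x + f.coeff 0) =
              4 * cubicEval f x *
              (((3 * x ^ 2 + 2 * f.coeff 2 * x + f.coeff 1) / (2 * d)) ^ 2 - f.coeff 2 - x - x - t) := by
            rw [div_pow, mul_pow, hQe]
            have : (2 ^ 2 * cubicEval f x) ≠ 0 := mul_ne_zero (pow_ne_zero _ h2) hf
            field_simp
            simp only [cubicEval]
            ring
          rw [e, mul_eq_zero, or_iff_right (mul_ne_zero h4 hf), sub_eq_zero, eq_comm]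
      rw [← key]
      rcases sq_eq_sq_iff_eq_or_eq_neg.1 (hRe.trans hQe.symm) with rfl | rfl
      · rw [sub_self]
        rfl
      · have hneg : Point.some x (-d) hR = -Point.some x d hQ := by
          rw [Point.neg_some, Point.some.injEq]
          exact ⟨rfl, by rw [negY_cubicCurve]⟩
        rw [hneg, neg_add_cancel, ← neg_add', xCoord_neg, or_comm]
        rfl
    · have hneg : -Point.some c d hQ =
          Point.some c (-d) (by rw [← negY_cubicCurve, nonsingular_neg]; exact hQ) := by
        rw [Point.neg_some, Point.some.injEq]
        exact ⟨rfl, by rw [negY_cubicCurve]⟩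
      rw [sub_eq_add_neg, hneg, xCoord_add_of_ne hR hQ hx, xCoord_add_of_ne hR _ hx]
      have hxc : x - c ≠ 0 := sub_ne_zero.2 hx
      cases t with
      | none => simp [xCoord, corr, hxc]
      | some t =>
        simp only [xCoord, corr, Option.some.injEq]
        -- As a quadratic in `t` the form has leading coefficient `(x - c)²`, and its roots are the
        -- abscissas that the chord formula gives for `R + Q` and `R - Q`.
        have e : (f.coeff 1 - (x * t + x * c + t * c)) ^ 2 -
              4 * (x + t + c + f.coeff 2) * (x * t * c + f.coeff 0) = (x - c) ^ 2 *
            ((t - (((y - d) / (x - c)) ^ 2 - f.coeff 2 - x - c)) *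
              (t - (((y - -d) / (x - c)) ^ 2 - f.coeff 2 - x - c))) := by
          have e₀ := hRe
          have e₁ := hQe
          simp only [cubicEval] at e₀ e₁
          have e₂ : f.coeff 1 = (y ^ 2 - d ^ 2 - (x ^ 3 - c ^ 3) - f.coeff 2 * (x ^ 2 - c ^ 2)) /
              (x - c) := by
            field_simp
            linear_combination e₁ - e₀
          have e₃ : f.coeff 0 = y ^ 2 - x ^ 3 - f.coeff 2 * x ^ 2 - f.coeff 1 * x := by
            linear_combination -e₀
          rw [e₃, e₂]
          field_simp
          ring
        rw [e, mul_eq_zero, or_iff_right (pow_ne_zero _ hxc), mul_eq_zero, sub_eq_zero, sub_eq_zero]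

end GroupLaw

/-! ### Points, lines and tangents in homogeneous coordinates. -/

section Plane

open Matrix

variable {F : Type*} [Field F] {K : Type*} [Field K] [Algebra F K]

lemma mk_mem_points {C : Conic F} {v : Fin 3 → K} (hv : v ≠ 0) :
    Projectivization.mk K v hv ∈ C.points K ↔ v ⬝ᵥ C.mat K *ᵥ v = 0 := by
  obtain ⟨a, ha⟩ := Projectivization.exists_smul_eq_mk_rep K v hv
  simp only [Conic.points, Set.mem_ofPred_eq, ← ha, Units.smul_def, mulVec_smul, smul_dotProduct,
    dotProduct_smul, smul_eq_mul, mul_eq_zero, a.ne_zero, false_or]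

lemma onLine_mk {v ξ : Fin 3 → K} (hv : v ≠ 0) (hξ : ξ ≠ 0) :
    OnLine (Projectivization.mk K v hv) (Projectivization.mk K ξ hξ) ↔ ξ ⬝ᵥ v = 0 := by
  obtain ⟨a, ha⟩ := Projectivization.exists_smul_eq_mk_rep K v hv
  obtain ⟨b, hb⟩ := Projectivization.exists_smul_eq_mk_rep K ξ hξ
  simp only [OnLine, ← ha, ← hb, Units.smul_def, smul_dotProduct, dotProduct_smul, smul_eq_mul,
    mul_eq_zero, a.ne_zero, b.ne_zero, false_or]

lemma isSmooth_iff_det_ne_zero {C : Conic F} : C.IsSmooth K ↔ (C.mat K).det ≠ 0 := by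
  constructor
  · intro h h0
    obtain ⟨v, hv, hv0⟩ := Matrix.exists_mulVec_eq_zero_iff.2 h0
    obtain ⟨a, ha⟩ := Projectivization.exists_smul_eq_mk_rep K v hv
    refine h (.mk K v hv) ((mk_mem_points hv).2 (by rw [hv0, dotProduct_zero])) ?_
    rw [← ha, Units.smul_def, mulVec_smul, hv0, smul_zero]
  · intro h X _ h0
    exact h (Matrix.exists_mulVec_eq_zero_iff.1 ⟨_, X.rep_nonzero, h0⟩)

/-- The line `ξ` can only touch the conic at `M⁻¹ ξ`, so the dual conic has matrix `M⁻¹`. -/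
lemma mk_mem_tangents {C : Conic F} (hC : (C.mat K).det ≠ 0) {ξ : Fin 3 → K} (hξ : ξ ≠ 0) :
    Projectivization.mk K ξ hξ ∈ C.tangents K ↔ ξ ⬝ᵥ (C.mat K)⁻¹ *ᵥ ξ = 0 := by
  have hu : IsUnit (C.mat K).det := isUnit_iff_ne_zero.2 hC
  obtain ⟨b, hb⟩ := Projectivization.exists_smul_eq_mk_rep K ξ hξ
  constructor
  · rintro ⟨X, hX, c, hc⟩
    have hX' : X.rep ⬝ᵥ C.mat K *ᵥ X.rep = 0 := hX
    have e : ξ = ((b⁻¹ : Kˣ) * c : K) • C.mat K *ᵥ X.rep := by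
      rw [mul_smul, ← hc, ← hb, Units.smul_def, smul_smul, Units.inv_mul, one_smul]
    rw [e, mulVec_smul, mulVec_mulVec, nonsing_inv_mul _ hu, one_mulVec, smul_dotProduct,
      dotProduct_smul, dotProduct_comm, hX', smul_zero, smul_zero]
  · intro h
    have e : C.mat K *ᵥ (C.mat K)⁻¹ *ᵥ ξ = ξ := by
      rw [mulVec_mulVec, mul_nonsing_inv _ hu, one_mulVec]
    have hv : (C.mat K)⁻¹ *ᵥ ξ ≠ 0 := by
      intro h0
      rw [h0, mulVec_zero] at e
      exact hξ e.symm
    obtain ⟨a, ha⟩ := Projectivization.exists_smul_eq_mk_rep K _ hv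
    refine ⟨.mk K _ hv, (mk_mem_points hv).2 (by rw [e, dotProduct_comm, h]), b * (a⁻¹ : Kˣ), ?_⟩
    rw [← ha, ← hb, Units.smul_def, Units.smul_def, mulVec_smul, e, smul_smul, mul_assoc,
      Units.inv_mul, mul_one]

end Plane

/-! ### The standard pair of conics. -/

section Model

open Matrix

variable {K : Type*} [Field K]

/-- The parametrization `t ↦ (1 : t : t²)` of the conic `X₁² = X₀ X₂`. -/
def vero : Option K → Fin 3 → K
  | none => ![0, 0, 1]
  | some t => ![1, t, t ^ 2]

/-- The line through the points with parameters `s` and `t` of the conic `X₁² = X₀ X₂`. -/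
def chordVec : Option K → Option K → Fin 3 → K
  | none, none => ![1, 0, 0]
  | none, some t => ![t, -1, 0]
  | some s, none => ![s, -1, 0]
  | some s, some t => ![s * t, -(s + t), 1]

/-- The conic `X₁² = X₀ X₂`. -/
def veroMat (K : Type*) [Field K] : Matrix (Fin 3) (Fin 3) K :=
  !![0, 0, -1; 0, 2, 0; -1, 0, 0]

/-- The pencil of conics which meet `X₁² = X₀ X₂` where the parameter is infinite or a root
of `f`. -/
def pencilMat (f : Polynomial K) (c : K) : Matrix (Fin 3) (Fin 3) K :=
  !![2 * f.coeff 0, f.coeff 1, -c; f.coeff 1, 2 * (f.coeff 2 + c), 1; -c, 1, 0]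

lemma vero_ne_zero (t : Option K) : vero t ≠ 0 := by
  intro h
  cases t with
  | none => simpa [vero] using congrFun h 2
  | some t => simpa [vero] using congrFun h 0

lemma chordVec_ne_zero (s t : Option K) : chordVec s t ≠ 0 := by
  intro h
  rcases s with _ | s <;> rcases t with _ | t
  · simpa [chordVec] using congrFun h 0
  · simpa [chordVec] using congrFun h 1
  · simpa [chordVec] using congrFun h 1
  · simpa [chordVec] using congrFun h 2

lemma chordVec_dotProduct_vero (s t r : Option K) :
    chordVec s t ⬝ᵥ vero r = 0 ↔ r = s ∨ r = t := by
  rcases s with _ | s <;> rcases t with _ | t <;> rcases r with _ | r <;>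
    simp [chordVec, vero, dotProduct, Fin.sum_univ_three, ← sub_eq_add_neg, sub_eq_zero]
  · exact eq_comm
  · exact eq_comm
  · rw [show s * t + (-t - s) * r + r ^ 2 = (r - s) * (r - t) by ring, mul_eq_zero, sub_eq_zero,
      sub_eq_zero]

lemma exists_vero_of_quadric (h2 : (2 : K) ≠ 0) {v : Fin 3 → K} (h : v ⬝ᵥ veroMat K *ᵥ v = 0) :
    ∃ (t : Option K) (a : K), v = a • vero t := by
  have h' : v 1 ^ 2 = v 0 * v 2 := by
    simp only [veroMat, dotProduct, mulVec, Fin.sum_univ_three, of_apply, cons_val', cons_val_zero,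
      cons_val_one, cons_val] at h
    have : 2 * (v 1 ^ 2 - v 0 * v 2) = 0 := by linear_combination h
    rw [mul_eq_zero, or_iff_right h2] at this
    exact sub_eq_zero.1 this
  by_cases h0 : v 0 = 0
  · refine ⟨none, v 2, ?_⟩
    have h1 : v 1 = 0 := by simpa [h0] using h'
    ext i
    fin_cases i <;> simp [vero, h0, h1]
  · refine ⟨some (v 1 / v 0), v 0, ?_⟩
    ext i
    fin_cases i <;> simp [vero]
    · field_simp
    · field_simp
      linear_combination -h'

/-- Restricting `η` to the parametrized conic gives a quadratic polynomial with root `s`; the other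
root is `t`. -/
lemma exists_chordVec_of_dotProduct_vero {η : Fin 3 → K} {s : Option K}
    (h : η ⬝ᵥ vero s = 0) : ∃ (t : Option K) (a : K), η = a • chordVec s t := by
  cases s with
  | none =>
    have h2 : η 2 = 0 := by simpa [vero, dotProduct, Fin.sum_univ_three] using h
    by_cases h1 : η 1 = 0
    · exact ⟨none, η 0, by ext i; fin_cases i <;> simp [chordVec, h1, h2]⟩
    · refine ⟨some (-η 0 / η 1), -η 1, ?_⟩
      ext i
      fin_cases i <;> simp [chordVec, h2]
      field_simp
  | some s =>
    have h' : η 0 + η 1 * s + η 2 * s ^ 2 = 0 := by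
      simpa [vero, dotProduct, Fin.sum_univ_three] using h
    by_cases h2 : η 2 = 0
    · refine ⟨none, -η 1, ?_⟩
      ext i
      fin_cases i <;> simp [chordVec, h2]
      linear_combination h' - h2 * s ^ 2
    · refine ⟨some (-η 1 / η 2 - s), η 2, ?_⟩
      ext i
      fin_cases i <;> simp [chordVec]
      · field_simp
        linear_combination h'
      · field_simp

lemma vero_quadric (t : Option K) : vero t ⬝ᵥ veroMat K *ᵥ vero t = 0 := by
  cases t <;> simp [vero, veroMat, dotProduct, mulVec, Fin.sum_univ_three]
  ring

lemma det_pencilMat (f : Polynomial K) (c : K) : (pencilMat f c).det = -2 * cubicEval f c := by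
  simp [pencilMat, det_fin_three, cubicEval]
  ring

/-- The bridge between geometry and group law: the adjugate is the dual conic up to a scalar, so
tangency of a chord to the second conic becomes the vanishing of `corr`. -/
lemma chordVec_adjugate_pencilMat (f : Polynomial K) (c : K) (s t : Option K) :
    chordVec s t ⬝ᵥ (pencilMat f c).adjugate *ᵥ chordVec s t = -corr f c s t := by
  rw [adjugate_fin_three]
  rcases s with _ | s <;> rcases t with _ | t <;>
    simp [chordVec, pencilMat, corr, dotProduct, mulVec, Fin.sum_univ_three] <;> ring

end Model

/-! ### The incidence curve as an elliptic curve, and the closure theorem. -/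

section Coordinates

open Matrix WeierstrassCurve.Affine

variable {F : Type*} [Field F] {K : Type*} [Field K] [Algebra F K]

lemma mulVec_ne_zero_of_det {W : Matrix (Fin 3) (Fin 3) K} (hW : W.det ≠ 0) {v : Fin 3 → K}
    (hv : v ≠ 0) : W *ᵥ v ≠ 0 :=
  fun h => hW (Matrix.exists_mulVec_eq_zero_iff.1 ⟨v, hv, h⟩)

lemma mulVec_dotProduct_mulVec_mulVec (W M : Matrix (Fin 3) (Fin 3) K) (v w : Fin 3 → K) :
    W *ᵥ v ⬝ᵥ M *ᵥ W *ᵥ w = v ⬝ᵥ (Wᵀ * M * W) *ᵥ w := by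
  rw [← mulVec_mulVec, ← mulVec_mulVec, dotProduct_mulVec v, vecMul_transpose]

lemma det_inv_transpose_ne_zero {W : Matrix (Fin 3) (Fin 3) K} (hW : W.det ≠ 0) :
    W⁻¹ᵀ.det ≠ 0 := by
  rw [det_transpose, det_nonsing_inv, Ring.inverse_eq_inv']
  exact inv_ne_zero hW

lemma cubicEval_ne_zero {f : Polynomial K} {c d : K} (hd : d ≠ 0)
    (hQ : (cubicCurve f).toAffine.Nonsingular c d) : cubicEval f c ≠ 0 := by
  rw [← equation_cubicCurve.1 hQ.1]
  exact pow_ne_zero _ hd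

/-- Coordinates `W` in which the pair of conics `A`, `B` takes the standard form `X₁² = X₀ X₂`,
`pencilMat f c`. -/
structure IsStandard (A B : Conic F) (W : Matrix (Fin 3) (Fin 3) K) (f : Polynomial K) (c : K) :
    Prop where
  det_ne_zero : W.det ≠ 0
  fst : ∃ a : K, a ≠ 0 ∧ Wᵀ * A.mat K * W = a • veroMat K
  snd : ∃ b : K, b ≠ 0 ∧ Wᵀ * B.mat K * W = b • pencilMat f c

variable {A B : Conic F} {W : Matrix (Fin 3) (Fin 3) K} {f : Polynomial K} {c : K}

/-- An unordered pair, possibly with equal entries, and one of its entries determine the other. So a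
Poncelet sequence is determined by its initial term. -/
lemma PonceletStep.unique {e e₁ e₂ : Plane K × DualPlane K}
    (h₁ : PonceletStep K A B e e₁) (h₂ : PonceletStep K A B e e₂) : e₁ = e₂ := by
  have pair : ∀ {α : Type _} {a b b' : α}, ({a, b} : Set α) = {a, b'} → b = b' := by
    intro α a b b' hab
    have i₁ : b ∈ ({a, b'} : Set α) := hab ▸ by simp
    have i₂ : b' ∈ ({a, b} : Set α) := hab ▸ by simp
    simp only [Set.mem_insert_iff, Set.mem_singleton_iff] at i₁ i₂
    grind
  have e1 : e₁.1 = e₂.1 := pair (h₁.1.symm.trans h₂.1)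
  refine Prod.ext e1 (pair (a := e.2) ?_)
  rw [← h₁.2, ← h₂.2, e1]

namespace IsStandard

/-- The point of `A` with parameter `t`. -/
def pt (h : IsStandard A B W f c) (t : Option K) : Plane K :=
  .mk K (W *ᵥ vero t) (mulVec_ne_zero_of_det h.det_ne_zero (vero_ne_zero t))

/-- The line through the points of `A` with parameters `s` and `t`. -/
def ln (h : IsStandard A B W f c) (s t : Option K) : DualPlane K :=
  .mk K (W⁻¹ᵀ *ᵥ chordVec s t)
    (mulVec_ne_zero_of_det (det_inv_transpose_ne_zero h.det_ne_zero) (chordVec_ne_zero s t))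

lemma onLine_pt_ln (h : IsStandard A B W f c) (r s t : Option K) :
    OnLine (h.pt r) (h.ln s t) ↔ r = s ∨ r = t := by
  have hu : IsUnit W.det := isUnit_iff_ne_zero.2 h.det_ne_zero
  rw [pt, ln, onLine_mk, mulVec_transpose, ← dotProduct_mulVec, mulVec_mulVec,
    nonsing_inv_mul _ hu, one_mulVec, chordVec_dotProduct_vero]

lemma pt_mem (h : IsStandard A B W f c) (t : Option K) : h.pt t ∈ A.points K := by
  obtain ⟨a, -, ha⟩ := h.fst
  rw [pt, mk_mem_points]
  rw [mulVec_dotProduct_mulVec_mulVec, ha, smul_mulVec, dotProduct_smul, vero_quadric, smul_zero]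

lemma exists_pt (h : IsStandard A B W f c) (h2 : (2 : K) ≠ 0) {X : Plane K}
    (hX : X ∈ A.points K) : ∃ t, X = h.pt t := by
  obtain ⟨a, ha0, ha⟩ := h.fst
  have hu : IsUnit W.det := isUnit_iff_ne_zero.2 h.det_ne_zero
  set v := W⁻¹ *ᵥ X.rep with hv
  have hv' : X.rep = W *ᵥ v := by rw [hv, mulVec_mulVec, mul_nonsing_inv _ hu, one_mulVec]
  have hX' : X.rep ⬝ᵥ A.mat K *ᵥ X.rep = 0 := hX
  rw [hv', mulVec_dotProduct_mulVec_mulVec, ha, smul_mulVec, dotProduct_smul, smul_eq_mul, mul_eq_zero, or_iff_right ha0] at hX'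
  obtain ⟨t, k, hk⟩ := exists_vero_of_quadric h2 hX'
  refine ⟨t, ?_⟩
  rw [pt, ← X.mk_rep, Projectivization.mk_eq_mk_iff']
  exact ⟨k, by rw [hv', hk, mulVec_smul]⟩

lemma exists_ln (h : IsStandard A B W f c) {ξ : DualPlane K} {s : Option K}
    (hξ : OnLine (h.pt s) ξ) : ∃ t, ξ = h.ln s t := by
  have hu : IsUnit W.det := isUnit_iff_ne_zero.2 h.det_ne_zero
  rw [← ξ.mk_rep, pt, onLine_mk, dotProduct_mulVec, ← mulVec_transpose] at hξ
  obtain ⟨t, k, hk⟩ := exists_chordVec_of_dotProduct_vero hξ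
  refine ⟨t, ?_⟩
  rw [ln, ← ξ.mk_rep, Projectivization.mk_eq_mk_iff']
  refine ⟨k, ?_⟩
  rw [← mulVec_smul, ← hk, mulVec_mulVec, ← transpose_mul, mul_nonsing_inv _ hu, transpose_one,
    one_mulVec]

lemma ln_mem (h : IsStandard A B W f c) (h2 : (2 : K) ≠ 0) (hs : cubicEval f c ≠ 0)
    (s t : Option K) : h.ln s t ∈ B.tangents K ↔ corr f c s t = 0 := by
  obtain ⟨b, hb0, hb⟩ := h.snd
  have hu : IsUnit W.det := isUnit_iff_ne_zero.2 h.det_ne_zero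
  have hd : (pencilMat f c).det ≠ 0 := by
    rw [det_pencilMat]
    exact mul_ne_zero (neg_ne_zero.2 h2) hs
  have hB : (B.mat K).det ≠ 0 := by
    intro h0
    have := congrArg det hb
    rw [det_mul, det_mul, h0, mul_zero, zero_mul, det_smul] at this
    exact mul_ne_zero (pow_ne_zero _ hb0) hd this.symm
  rw [ln, mk_mem_tangents hB]
  have hinv : W⁻¹ * ((B.mat K)⁻¹ * W⁻¹ᵀ) = (b⁻¹ * (pencilMat f c).det⁻¹) •
      (pencilMat f c).adjugate := by
    have e : W⁻¹ * ((B.mat K)⁻¹ * W⁻¹ᵀ) = (Wᵀ * B.mat K * W)⁻¹ := by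
      rw [Matrix.mul_inv_rev, Matrix.mul_inv_rev, transpose_nonsing_inv]
    let _ : Invertible b := invertibleOfNonzero hb0
    rw [e, hb, Matrix.inv_smul _ b (isUnit_iff_ne_zero.2 hd), invOf_eq_inv, inv_def,
      Ring.inverse_eq_inv', smul_smul]
  rw [mulVec_dotProduct_mulVec_mulVec, transpose_transpose, Matrix.mul_assoc, hinv, smul_mulVec, dotProduct_smul, chordVec_adjugate_pencilMat, smul_eq_mul, mul_eq_zero,
    or_iff_right (mul_ne_zero (inv_ne_zero hb0) (inv_ne_zero hd)), neg_eq_zero]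

lemma pt_injective (h : IsStandard A B W f c) : Function.Injective h.pt := by
  intro s t hst
  have := (h.onLine_pt_ln t s s).1 (by rw [← hst, h.onLine_pt_ln]; exact Or.inl rfl)
  exact (or_self_iff.1 this).symm

lemma ln_injective (h : IsStandard A B W f c) {s t t' : Option K} (he : h.ln s t = h.ln s t') :
    t = t' := by
  have h₁ := h.onLine_pt_ln t s t'
  have h₂ := h.onLine_pt_ln t' s t
  rw [← he, h.onLine_pt_ln] at h₁
  rw [he, h.onLine_pt_ln] at h₂
  grind

lemma points_on_ln (h : IsStandard A B W f c) (h2 : (2 : K) ≠ 0) (s t : Option K) :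
    {X | X ∈ A.points K ∧ OnLine X (h.ln s t)} = {h.pt s, h.pt t} := by
  ext X
  constructor
  · rintro ⟨hX, hl⟩
    obtain ⟨r, rfl⟩ := h.exists_pt h2 hX
    rcases (h.onLine_pt_ln r s t).1 hl with rfl | rfl <;> simp
  · rintro (rfl | rfl)
    · exact ⟨h.pt_mem _, (h.onLine_pt_ln _ _ _).2 (Or.inl rfl)⟩
    · exact ⟨h.pt_mem _, (h.onLine_pt_ln _ _ _).2 (Or.inr rfl)⟩

lemma ln_comm (h : IsStandard A B W f c) (s t : Option K) : h.ln s t = h.ln t s := by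
  have : chordVec s t = chordVec t s := by
    rcases s with _ | s <;> rcases t with _ | t <;> simp [chordVec, mul_comm, add_comm]
  simp only [ln, this]

variable [DecidableEq K]

/-- The point of the incidence curve attached to a point `R` of `y² = f(x)`, relative to the
translation by `Q`. -/
def toIncidence (h : IsStandard A B W f c) (Q R : (cubicCurve f).toAffine.Point) :
    Plane K × DualPlane K :=
  (h.pt (xCoord R), h.ln (xCoord R) (xCoord (R + Q)))

variable {d : K} (h : IsStandard A B W f c) (h2 : (2 : K) ≠ 0) (hd : d ≠ 0)
  (hQ : (cubicCurve f).toAffine.Nonsingular c d)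

include h2 hd

lemma tangents_through_pt (R : (cubicCurve f).toAffine.Point) :
    {ξ | ξ ∈ B.tangents K ∧ OnLine (h.pt (xCoord R)) ξ} =
      {h.ln (xCoord R) (xCoord (R - .some c d hQ)),
        h.ln (xCoord R) (xCoord (R + .some c d hQ))} := by
  ext ξ
  constructor
  · rintro ⟨hξ, hl⟩
    obtain ⟨t, rfl⟩ := h.exists_ln hl
    rw [h.ln_mem h2 (cubicEval_ne_zero hd hQ), corr_eq_zero_iff h2 hd hQ] at hξ
    rcases hξ with rfl | rfl <;> simp
  · rintro (rfl | rfl)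
    · exact ⟨(h.ln_mem h2 (cubicEval_ne_zero hd hQ) _ _).2 ((corr_eq_zero_iff h2 hd hQ _ _).2 (Or.inr rfl)),
        (h.onLine_pt_ln _ _ _).2 (Or.inl rfl)⟩
    · exact ⟨(h.ln_mem h2 (cubicEval_ne_zero hd hQ) _ _).2 ((corr_eq_zero_iff h2 hd hQ _ _).2 (Or.inl rfl)),
        (h.onLine_pt_ln _ _ _).2 (Or.inl rfl)⟩

/-- The Poncelet map is translation by `Q`: the tangents through the point with parameter `x(R + Q)`
lead to the parameters `x(R)` and `x(R + 2Q)`. -/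
lemma ponceletStep_toIncidence (R : (cubicCurve f).toAffine.Point) :
    PonceletStep K A B (h.toIncidence (.some c d hQ) R)
      (h.toIncidence (.some c d hQ) (R + .some c d hQ)) := by
  refine ⟨h.points_on_ln h2 _ _, ?_⟩
  have := h.tangents_through_pt h2 hd hQ (R + .some c d hQ)
  rwa [add_sub_cancel_right, h.ln_comm _ (xCoord R)] at this

lemma toIncidence_injective : Function.Injective (h.toIncidence (.some c d hQ)) := by
  intro R S hRS
  rw [toIncidence, toIncidence, Prod.mk.injEq] at hRS
  have hx := h.pt_injective hRS.1
  rw [hx] at hRS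
  have hx' := h.ln_injective hRS.2
  rcases eq_or_eq_neg_of_xCoord_eq hx with e | rfl
  · exact e
  rcases eq_or_eq_neg_of_xCoord_eq hx' with e | e
  · exact add_right_cancel e
  -- Otherwise `R = -S` and `-S + Q = -(S + Q)`, so `Q = -Q`, which `d ≠ 0` forbids.
  · exfalso
    have e' : (Point.some c d hQ : (cubicCurve f).toAffine.Point) = -Point.some c d hQ := by
      have : -S + (Point.some c d hQ) = -S + -Point.some c d hQ := by rw [e, neg_add]
      exact add_left_cancel this
    rw [Point.neg_some, Point.some.injEq, negY_cubicCurve] at e'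
    have : 2 * d = 0 := by linear_combination e'.2
    simp [h2, hd] at this

lemma exists_toIncidence [IsAlgClosed K] (hf : ∀ x, (∃ y : K, y ^ 2 = cubicEval f x ∧
    (cubicCurve f).toAffine.Nonsingular x y)) {e : Plane K × DualPlane K}
    (he : e ∈ incidenceCurve K A B) : ∃ R, e = h.toIncidence (.some c d hQ) R := by
  obtain ⟨X, ξ⟩ := e
  obtain ⟨hX, hξ, hl⟩ := he
  obtain ⟨s, rfl⟩ := h.exists_pt h2 hX
  obtain ⟨t, rfl⟩ := h.exists_ln hl
  obtain ⟨R, rfl⟩ : ∃ R : (cubicCurve f).toAffine.Point, s = xCoord R := by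
    cases s with
    | none => exact ⟨.zero, rfl⟩
    | some s =>
      obtain ⟨y, -, hy⟩ := hf s
      exact ⟨.some s y hy, rfl⟩
  simp only at hξ
  rw [h.ln_mem h2 (cubicEval_ne_zero hd hQ), corr_eq_zero_iff h2 hd hQ] at hξ
  rcases hξ with rfl | rfl
  · exact ⟨R, rfl⟩
  -- The abscissas of `-R` and `-R + Q` are those of `R` and `R - Q`.
  · refine ⟨-R, ?_⟩
    rw [toIncidence, xCoord_neg, ← xCoord_neg (-R + _), neg_add, neg_neg, ← sub_eq_add_neg]

include h

/-- Poncelet's closure theorem, in the form of Cayley and Griffiths–Harris. -/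
theorem ponceletCondition_iff [IsAlgClosed K] (hf : ∀ x, (∃ y : K, y ^ 2 = cubicEval f x ∧
    (cubicCurve f).toAffine.Nonsingular x y)) (n : ℕ) :
    PonceletCondition K n A B ↔ n • (Point.some c d hQ) = 0 := by
  constructor
  · rintro ⟨s, h0, hstep, hn⟩
    obtain ⟨R, hR⟩ := h.exists_toIncidence h2 hd hQ hf h0
    have key : ∀ i, s i = h.toIncidence (.some c d hQ) (R + i • .some c d hQ) := by
      intro i
      induction i with
      | zero => rw [hR, zero_smul, add_zero]
      | succ i ih =>
        refine (hstep i).unique ?_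
        rw [ih, succ_nsmul, ← add_assoc]
        exact h.ponceletStep_toIncidence h2 hd hQ _
    rw [key n, hR] at hn
    simpa using h.toIncidence_injective h2 hd hQ hn
  · intro hn
    refine ⟨fun i => h.toIncidence (.some c d hQ) (i • .some c d hQ), ?_, fun i => ?_, ?_⟩
    · refine ⟨h.pt_mem _, (h.ln_mem h2 (cubicEval_ne_zero hd hQ) _ _).2 ((corr_eq_zero_iff h2 hd hQ _ _).2 (Or.inl rfl)),
        (h.onLine_pt_ln _ _ _).2 (Or.inl rfl)⟩
    · simp only [succ_nsmul]
      exact h.ponceletStep_toIncidence h2 hd hQ _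
    · simp only [hn, zero_smul]

end IsStandard
end Coordinates

/-! ### Bilinear forms of the members of a pencil. -/

section BilinearForm

open Matrix

variable {F : Type*} [Field F] {K : Type*} [Field K] [Algebra F K]

/-- The bilinear form over `K` attached to a symmetric matrix over `F`. -/
def bil (M : symMatrices F) (v w : Fin 3 → K) : K :=
  v ⬝ᵥ (M : Matrix (Fin 3) (Fin 3) F).map (algebraMap F K) *ᵥ w

lemma bil_comm (M : symMatrices F) (v w : Fin 3 → K) : bil M v w = bil M w v := by
  have hM : (M : Matrix (Fin 3) (Fin 3) F)ᵀ = M := M.2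
  rw [bil, bil, dotProduct_mulVec, ← mulVec_transpose, ← transpose_map, hM, dotProduct_comm]

lemma bil_add_left (M : symMatrices F) (v v' w : Fin 3 → K) :
    bil M (v + v') w = bil M v w + bil M v' w := add_dotProduct _ _ _

lemma bil_smul_left (M : symMatrices F) (a : K) (v w : Fin 3 → K) :
    bil M (a • v) w = a * bil M v w := smul_dotProduct _ _ _

lemma bil_add_right (M : symMatrices F) (v w w' : Fin 3 → K) :
    bil M v (w + w') = bil M v w + bil M v w' := by
  rw [bil, mulVec_add, dotProduct_add, bil, bil]

lemma bil_smul_right (M : symMatrices F) (a : K) (v w : Fin 3 → K) :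
    bil M v (a • w) = a * bil M v w := by
  rw [bil, mulVec_smul, dotProduct_smul, smul_eq_mul, bil]

lemma bil_add (M N : symMatrices F) (v w : Fin 3 → K) :
    bil (M + N) v w = bil M v w + bil N v w := by
  rw [bil, bil, bil, ← dotProduct_add, ← add_mulVec]
  congr 2
  ext i j
  simp

lemma bil_smul (a : F) (M : symMatrices F) (v w : Fin 3 → K) :
    bil (a • M) v w = algebraMap F K a * bil M v w := by
  rw [bil, bil, ← smul_eq_mul, ← dotProduct_smul, ← smul_mulVec]
  congr 2
  ext i j
  simp

lemma bil_zero_left (M : symMatrices F) (w : Fin 3 → K) : bil M 0 w = 0 := zero_dotProduct _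

lemma bil_pow_card [Fintype F] (M : symMatrices F) (v w : Fin 3 → K) :
    bil M v w ^ Fintype.card F =
      bil M (fun i => v i ^ Fintype.card F) (fun i => w i ^ Fintype.card F) := by
  have h : ∀ x : K, x ^ Fintype.card F = FiniteField.frobeniusAlgHom F K x := fun _ => rfl
  simp only [h, bil, dotProduct, mulVec, map_sum, map_mul, map_apply, AlgHom.commutes]

end BilinearForm

/-! ### Normalized coordinates of the base points. -/

section BasePoints

variable {F : Type*} [Field F] {K : Type*} [Field K] [Algebra F K]

lemma mk_mem_members {P : Pencil F} {M : symMatrices F} (hM : M ≠ 0) :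
    (Projectivization.mk F M hM : Conic F) ∈ P.members ↔ M ∈ P.space := by
  obtain ⟨a, ha⟩ := Projectivization.exists_smul_eq_mk_rep F M hM
  change (Projectivization.mk F M hM).rep ∈ P.space ↔ _
  rw [← ha]
  exact Submodule.smul_mem_iff_of_isUnit _ a.isUnit

lemma bil_rep_mk {M : symMatrices F} (hM : M ≠ 0) {v w : Fin 3 → K} :
    bil (Projectivization.mk F M hM : Conic F).rep v w = 0 ↔ bil M v w = 0 := by
  obtain ⟨a, ha⟩ := Projectivization.exists_smul_eq_mk_rep F M hM
  rw [← ha, Units.smul_def, bil_smul, mul_eq_zero, or_iff_right]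
  simp

lemma mk_mem_basePoints {P : Pencil F} {v : Fin 3 → K} (hv : v ≠ 0) :
    Projectivization.mk K v hv ∈ P.basePoints K ↔ ∀ M ∈ P.space, bil M v v = 0 := by
  constructor
  · intro h M hM
    by_cases h0 : M = 0
    · rw [h0, ← zero_smul F (0 : symMatrices F), bil_smul, map_zero, zero_mul]
    · exact (bil_rep_mk h0).1 ((mk_mem_points hv).1 (h _ ((mk_mem_members h0).2 hM)))
  · intro h C hC
    exact (mk_mem_points hv).2 (h _ hC)

/-- No three base points are collinear: a conic through three points of a line contains the line, so
the base locus would be infinite. -/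
lemma coeff_eq_zero_of_relation [Infinite K] (h2 : (2 : K) ≠ 0) {P : Pencil F} {p : Fin 4 → Plane K}
    (hp : Function.Injective p) (hP : P.basePoints K = Set.range p) {a b c : Fin 4} (hab : a ≠ b)
    (hac : a ≠ c) (hbc : b ≠ c) {r s t : K}
    (h : r • (p a).rep + s • (p b).rep + t • (p c).rep = 0) : t = 0 := by
  by_contra ht
  have self : ∀ i, ∀ M ∈ P.space, bil M (p i).rep (p i).rep = 0 := by
    intro i
    rw [← mk_mem_basePoints (p i).rep_nonzero, Projectivization.mk_rep, hP]
    exact Set.mem_range_self i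
  have hab' := (Projectivization.linearIndependent_pair_iff_ne (K := K)).2 (hp.ne hab)
  have hbc' := (Projectivization.linearIndependent_pair_iff_ne (K := K)).2 (hp.ne hbc)
  have hac' := (Projectivization.linearIndependent_pair_iff_ne (K := K)).2 (hp.ne hac)
  rw [LinearIndependent.pair_iff] at hab' hbc' hac'
  have hr : r ≠ 0 := by
    rintro rfl
    rw [zero_smul, zero_add] at h
    exact ht (hbc' _ _ h).2
  have hs : s ≠ 0 := by
    rintro rfl
    rw [zero_smul, add_zero] at h
    exact ht (hac' _ _ h).2
  have hbil : ∀ M ∈ P.space, bil M (p a).rep (p b).rep = 0 := by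
    intro M hM
    have e : (-t) • (p c).rep = r • (p a).rep + s • (p b).rep := by
      rw [neg_smul, eq_comm, ← add_eq_zero_iff_eq_neg, h]
    have := congrArg (fun v => bil M v v) e
    simp only [bil_smul_left, bil_smul_right, bil_add_left, bil_add_right, self _ M hM,
      bil_comm M (p b).rep (p a).rep] at this
    have h' : 2 * (r * s) * bil M (p a).rep (p b).rep = 0 := by linear_combination -this
    rwa [mul_eq_zero, or_iff_right (mul_ne_zero h2 (mul_ne_zero hr hs))] at h'
  have hne : ∀ x : K, (p a).rep + x • (p b).rep ≠ 0 := fun x h0 => by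
    have := hab' 1 x (by rwa [one_smul])
    exact one_ne_zero this.1
  have hinj : Function.Injective fun x : K => Projectivization.mk K _ (hne x) := by
    intro x y hxy
    obtain ⟨k, hk⟩ := (Projectivization.mk_eq_mk_iff' K _ _ _ _).1 hxy
    have := hab' (k - 1) (k * y - x) (by
      rw [sub_smul, sub_smul, one_smul, mul_smul]
      rw [smul_add] at hk
      rw [sub_add_sub_comm, hk, sub_self])
    have hk1 := sub_eq_zero.1 this.1
    rw [hk1, one_mul] at this
    exact (sub_eq_zero.1 this.2).symm
  refine Set.infinite_of_injective_forall_mem hinj (s := P.basePoints K) (fun x => ?_)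
    (hP ▸ Set.finite_range p)
  rw [mk_mem_basePoints]
  intro M hM
  simp only [bil_smul_left, bil_smul_right, bil_add_left, bil_add_right, self _ M hM, hbil M hM,
    bil_comm M (p b).rep (p a).rep, mul_zero, add_zero]

/-- Normalized coordinate vectors of the four base points of a pencil: their sum is `0`, and the
Frobenius permutes them. -/
structure IsFrame [Fintype F] (P : Pencil F) (u : Fin 4 → Fin 3 → K)
    (σ : Equiv.Perm (Fin 4)) : Prop where
  sum_eq_zero : ∑ i, u i = 0
  eq_of_sum_eq_zero : ∀ g : Fin 4 → K, ∑ i, g i • u i = 0 → ∀ i j, g i = g j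
  bil_self : ∀ M ∈ P.space, ∀ i, bil M (u i) (u i) = 0
  pow_card : ∀ i j, u i j ^ Fintype.card F = u (σ i) j

theorem exists_isFrame [Fintype F] [IsAlgClosed K] (h2 : (2 : K) ≠ 0) {P : Pencil F}
    {p : Fin 4 → Plane K} {σ : Equiv.Perm (Fin 4)} (hp : Function.Injective p)
    (hP : P.basePoints K = Set.range p) (hσ : ∀ i, frobPoint F (p i) = p (σ i)) :
    ∃ u : Fin 4 → Fin 3 → K, IsFrame P u σ := by
  have : Infinite K := IsAlgClosed.instInfinite
  have rel := fun {a b c : Fin 4} (hab : a ≠ b) (hac : a ≠ c) (hbc : b ≠ c) {r s t : K} =>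
    coeff_eq_zero_of_relation (r := r) (s := s) (t := t) h2 hp hP hab hac hbc
  have rel' : ∀ g : Fin 4 → K, ∑ i, g i • (p i).rep = 0 → (∃ i, g i = 0) → g = 0 := by
    intro g hg ⟨i, hi⟩
    rw [Fin.sum_univ_four] at hg
    have key : ∀ j, g j = 0 := by
      intro j
      by_cases hij : j = i
      · rw [hij, hi]
      obtain ⟨a, b, hab, haj, hbj, hai, hbi⟩ : ∃ a b : Fin 4, a ≠ b ∧ a ≠ j ∧ b ≠ j ∧ a ≠ i ∧
          b ≠ i := by
        clear hg hi
        revert i j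
        decide
      refine rel hab haj hbj (r := g a) (s := g b) ?_
      have huniv : (Finset.univ : Finset (Fin 4)) = {a, b, j, i} := by
        clear hg hi rel
        revert a b i j
        decide
      have := hg
      rw [← Fin.sum_univ_four (fun i => g i • (p i).rep), huniv, Finset.sum_insert (by simp [*]),
        Finset.sum_insert (by simp [*]), Finset.sum_insert (by simp [*]), Finset.sum_singleton, hi,
        zero_smul, add_zero, ← add_assoc] at this
      exact this
    exact funext key
  -- Four vectors in a space of dimension three are dependent. By `rel'` the relation has no zero
  -- coefficient and is unique up to a scalar.
  obtain ⟨g, hg, i₀, hi₀⟩ : ∃ g : Fin 4 → K, ∑ i, g i • (p i).rep = 0 ∧ ∃ i, g i ≠ 0 := by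
    have : ¬ LinearIndependent K fun i => (p i).rep := by
      intro h
      have := h.fintype_card_le_finrank
      simp at this
    rw [Fintype.linearIndependent_iff] at this
    push Not at this
    exact this
  have hg0 : ∀ i, g i ≠ 0 := fun i hi => hi₀ (congrFun (rel' g hg ⟨i, hi⟩) i₀)
  have huniq : ∀ c : Fin 4 → K, ∑ i, c i • g i • (p i).rep = 0 → ∀ i j, c i = c j := by
    intro c hc i j
    have h0 := rel' (fun k => (c k - c j) * g k) ?_ ⟨j, by simp⟩
    · have := congrFun h0 i
      simp only [Pi.zero_apply, mul_eq_zero, hg0 i, or_false] at this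
      exact sub_eq_zero.1 this
    · simp only [mul_smul, sub_smul, Finset.sum_sub_distrib, ← Finset.smul_sum, hc, hg, smul_zero,
        sub_zero]
  have hfr : ∀ i, ∃ k : K, (fun j => (g i • (p i).rep) j ^ Fintype.card F) =
      k • (g (σ i) • (p (σ i)).rep) := by
    intro i
    have h := hσ i
    rw [frobPoint, ← (p (σ i)).mk_rep, Projectivization.mk_eq_mk_iff'] at h
    obtain ⟨a, ha⟩ := h
    refine ⟨g i ^ Fintype.card F * a * (g (σ i))⁻¹, ?_⟩
    rw [smul_smul, inv_mul_cancel_right₀ (hg0 _), mul_smul, ha]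
    ext j
    simp [mul_pow]
  choose k hk using hfr
  -- Frobenius maps the relation to another relation among the same vectors, so uniqueness makes the
  -- factors `k i` equal.
  have hkall : ∀ i j, k i = k j := by
    have hsum : ∑ i, k (σ.symm i) • g i • (p i).rep = 0 := by
      rw [← Equiv.sum_comp σ]
      simp only [Equiv.symm_apply_apply, ← hk]
      ext j
      have := congrArg (FiniteField.frobeniusAlgHom F K) (congrFun hg j)
      simpa using this
    intro i j
    simpa using huniq (fun i => k (σ.symm i)) hsum (σ i) (σ j)
  have hk0 : k 0 ≠ 0 := by
    intro h0
    have := hk 0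
    rw [h0, zero_smul] at this
    apply (p 0).rep_nonzero
    ext j
    have := congrFun this j
    simpa [hg0] using this
  have hq : 0 < Fintype.card F - 1 := Nat.sub_pos_of_lt Fintype.one_lt_card
  -- Scaling all vectors by `μ` multiplies the common factor by `μ ^ (q - 1)`, which is chosen to
  -- cancel it.
  obtain ⟨μ, hμ⟩ := IsAlgClosed.exists_pow_nat_eq (k 0)⁻¹ hq
  have hμ0 : μ ≠ 0 := by
    rintro rfl
    rw [zero_pow hq.ne'] at hμ
    exact inv_ne_zero hk0 hμ.symm
  refine ⟨fun i => μ • g i • (p i).rep, ?_, ?_, ?_, ?_⟩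
  · rw [← Finset.smul_sum, hg, smul_zero]
  · intro c hc i j
    refine huniq c ?_ i j
    simp only [smul_comm _ μ, ← Finset.smul_sum] at hc
    exact (smul_eq_zero.1 hc).resolve_left hμ0
  · intro M hM i
    have : bil M (p i).rep (p i).rep = 0 := by
      revert M
      rw [← mk_mem_basePoints (p i).rep_nonzero, Projectivization.mk_rep, hP]
      exact Set.mem_range_self i
    simp only [bil_smul_left, bil_smul_right, this, mul_zero]
  · intro i j
    have := congrFun (hk i) j
    simp only [Pi.smul_apply, smul_eq_mul] at this ⊢
    rw [mul_pow, this, hkall i 0, show Fintype.card F = Fintype.card F - 1 + 1 by omega, pow_succ,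
      hμ]
    field_simp

/-- Renumbering the base points conjugates `σ`, which allows a fixed representative of the induced
action on splittings. -/
lemma IsFrame.relabel [Fintype F] {P : Pencil F} {u : Fin 4 → Fin 3 → K} {σ : Equiv.Perm (Fin 4)}
    (h : IsFrame P u σ) (π : Equiv.Perm (Fin 4)) : IsFrame P (u ∘ π) (π⁻¹ * σ * π) where
  sum_eq_zero := by rw [← h.sum_eq_zero]; exact Equiv.sum_comp π u
  eq_of_sum_eq_zero g hg i j := by
    have := h.eq_of_sum_eq_zero (g ∘ π.symm)
      (by rw [← hg, ← Equiv.sum_comp π]; simp) (π i) (π j)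
    simpa using this
  bil_self M hM i := h.bil_self M hM _
  pow_card i j := by simp [h.pow_card]

end BasePoints

/-! ### Degenerate members and simultaneous standard form. -/

section Splittings

open Matrix Polynomial

variable {F : Type*} [Field F] {K : Type*} [Field K] [Algebra F K]

/-- The three splittings of four points into two pairs: the splitting which has `a`, `b` as one of
its pairs. -/
def splitting : Fin 4 → Fin 4 → Fin 3 :=
  -- The diagonal entries are placeholders; only pairs of distinct indices are meaningful.
  ![![0, 2, 1, 0], ![2, 0, 0, 1], ![1, 0, 0, 2], ![0, 1, 2, 0]]

/-- The linear form on a pencil which vanishes at the degenerate member that belongs to a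
splitting of the base points. -/
def splitForm (u : Fin 4 → Fin 3 → K) (i : Fin 3) : symMatrices F →ₗ[F] K where
  toFun M := ![bil M (u 1) (u 2), bil M (u 0) (u 2), bil M (u 0) (u 1)] i
  map_add' M N := by fin_cases i <;> simp [bil_add]
  map_smul' a M := by fin_cases i <;> simp [bil_smul, Algebra.smul_def]

variable {u : Fin 4 → Fin 3 → K} {P : Pencil F} {M : symMatrices F}

lemma splitForm_zero : splitForm u 0 M = bil M (u 1) (u 2) := rfl
lemma splitForm_one : splitForm u 1 M = bil M (u 0) (u 2) := rfl
lemma splitForm_two : splitForm u 2 M = bil M (u 0) (u 1) := rfl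

variable [Fintype F] {σ : Equiv.Perm (Fin 4)}

namespace IsFrame

lemma bil_left (h : IsFrame P u σ) (v : Fin 3 → K) :
    bil M (u 0) v + bil M (u 1) v + bil M (u 2) v + bil M (u 3) v = 0 := by
  rw [← bil_add_left, ← bil_add_left, ← bil_add_left, ← Fin.sum_univ_four, h.sum_eq_zero,
    bil_zero_left]

lemma sum_splitForm (h : IsFrame P u σ) (h2 : (2 : K) ≠ 0) (hM : M ∈ P.space) :
    splitForm u 0 M + splitForm u 1 M + splitForm u 2 M = 0 := by
  rw [splitForm_zero, splitForm_one, splitForm_two]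
  have b := fun i j => bil_comm M (u i) (u j)
  have : 2 * (bil M (u 1) (u 2) + bil M (u 0) (u 2) + bil M (u 0) (u 1)) = 0 := by
    linear_combination h.bil_left (M := M) (u 0) + h.bil_left (M := M) (u 1) +
      h.bil_left (M := M) (u 2) - h.bil_left (M := M) (u 3) + h.bil_self M hM 3 -
      h.bil_self M hM 0 - h.bil_self M hM 1 - h.bil_self M hM 2 - b 1 0 - b 2 0 - b 2 1
      - b 3 0 - b 3 1 - b 3 2
  exact (mul_eq_zero.1 this).resolve_left h2

/-- The Gram matrix of the four vectors is symmetric with zero diagonal and zero row sums. This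
forces entries at complementary pairs to agree, so an entry depends only on the splitting. -/
lemma bil_eq_splitForm (h : IsFrame P u σ) (h2 : (2 : K) ≠ 0) (hM : M ∈ P.space) {a b : Fin 4}
    (hab : a ≠ b) : bil M (u a) (u b) = splitForm u (splitting a b) M := by
  have hs := h.sum_splitForm h2 hM
  have h0 := h.bil_left (M := M) (u 0)
  have h1 := h.bil_left (M := M) (u 1)
  have h3 := h.bil_left (M := M) (u 2)
  rw [h.bil_self M hM] at h0 h1 h3
  rw [bil_comm M (u 1) (u 0), bil_comm M (u 2) (u 0)] at h0
  rw [bil_comm M (u 2) (u 1)] at h1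
  rw [splitForm_zero, splitForm_one, splitForm_two] at hs
  have e0 : bil M (u 3) (u 0) = bil M (u 1) (u 2) := by linear_combination h0 - hs
  have e1 : bil M (u 3) (u 1) = bil M (u 0) (u 2) := by linear_combination h1 - hs
  have e2 : bil M (u 3) (u 2) = bil M (u 0) (u 1) := by linear_combination h3 - hs
  revert hab
  fin_cases a <;> fin_cases b <;> intro hab <;>
    first
    | exact absurd rfl hab
    | rfl
    | exact bil_comm _ _ _
    | exact e0
    | exact e1
    | exact e2
    | exact (bil_comm _ _ _).trans e0
    | exact (bil_comm _ _ _).trans e1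
    | exact (bil_comm _ _ _).trans e2

lemma splitForm_pow_card (h : IsFrame P u σ) (h2 : (2 : K) ≠ 0) (hM : M ∈ P.space) {a b : Fin 4}
    (hab : a ≠ b) : splitForm u (splitting a b) M ^ Fintype.card F =
      splitForm u (splitting (σ a) (σ b)) M := by
  rw [← h.bil_eq_splitForm h2 hM hab, ← h.bil_eq_splitForm h2 hM (σ.injective.ne hab),
    bil_pow_card]
  simp only [h.pow_card]

end IsFrame

/-- The matrix whose columns are the first three base points. -/
def frameMat (u : Fin 4 → Fin 3 → K) : Matrix (Fin 3) (Fin 3) K :=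
  Matrix.of fun i j => u j.castSucc i

namespace IsFrame

lemma det_frameMat_ne_zero (h : IsFrame P u σ) : (frameMat u).det ≠ 0 := by
  intro h0
  obtain ⟨g, hg, hg0⟩ := Matrix.exists_mulVec_eq_zero_iff.2 h0
  have := h.eq_of_sum_eq_zero (Fin.snoc g 0) (by
    rw [Fin.sum_univ_castSucc]
    simp only [Fin.snoc_castSucc, Fin.snoc_last, zero_smul, add_zero]
    rw [← hg0]
    ext j
    simp [mulVec, dotProduct, frameMat, mul_comm])
  apply hg
  ext j
  have := this j.castSucc (Fin.last 3)
  rwa [Fin.snoc_castSucc, Fin.snoc_last] at this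

lemma gram (h : IsFrame P u σ) (hM : M ∈ P.space) :
    (frameMat u)ᵀ * (M : Matrix (Fin 3) (Fin 3) F).map (algebraMap F K) * frameMat u =
      !![0, splitForm u 2 M, splitForm u 1 M; splitForm u 2 M, 0, splitForm u 0 M;
        splitForm u 1 M, splitForm u 0 M, 0] := by
  have e : (frameMat u)ᵀ * (M : Matrix (Fin 3) (Fin 3) F).map (algebraMap F K) * frameMat u =
      Matrix.of fun i j : Fin 3 => bil M (u i.castSucc) (u j.castSucc) := by
    ext i j
    rw [Matrix.mul_assoc]
    simp only [mul_apply, bil, dotProduct, mulVec, frameMat, transpose_apply, of_apply]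
  rw [e]
  ext i j
  fin_cases i <;> fin_cases j
  · exact h.bil_self M hM 0
  · rfl
  · rfl
  · exact bil_comm _ _ _
  · exact h.bil_self M hM 1
  · rfl
  · exact bil_comm _ _ _
  · exact bil_comm _ _ _
  · exact h.bil_self M hM 2

/-- The Gram determinant of the first three base vectors is twice the product of the three split
forms. -/
lemma det_ne_zero_iff (h : IsFrame P u σ) (h2 : (2 : K) ≠ 0) (hM : M ∈ P.space) :
    ((M : Matrix (Fin 3) (Fin 3) F).map (algebraMap F K)).det ≠ 0 ↔ ∀ i, splitForm u i M ≠ 0 := by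
  have hg := congrArg det (h.gram hM)
  rw [det_mul, det_mul, det_transpose, det_fin_three !![_, _, _; _, _, _; _, _, _]] at hg
  have e : (frameMat u).det ^ 2 * ((M : Matrix (Fin 3) (Fin 3) F).map (algebraMap F K)).det =
      2 * (splitForm u 0 M * splitForm u 1 M * splitForm u 2 M) := by
    simp at hg
    linear_combination hg
  have hd := pow_ne_zero 2 h.det_frameMat_ne_zero
  constructor
  · intro h' i hi
    apply mul_ne_zero hd h'
    rw [e]
    fin_cases i <;> simp_all
  · intro h' h0
    rw [h0, mul_zero] at e
    exact mul_ne_zero h2 (mul_ne_zero (mul_ne_zero (h' 0) (h' 1)) (h' 2)) e.symm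

lemma eq_zero_of_splitForm (h : IsFrame P u σ) (hM : M ∈ P.space) (h0 : ∀ i, splitForm u i M = 0) :
    M = 0 := by
  have hu : IsUnit (frameMat u).det := isUnit_iff_ne_zero.2 h.det_frameMat_ne_zero
  have hut : IsUnit (frameMat u)ᵀ.det := by rwa [det_transpose]
  have hg := h.gram hM
  rw [h0, h0, h0] at hg
  have hz : !![(0 : K), 0, 0; 0, 0, 0; 0, 0, 0] = 0 := by
    ext i j
    fin_cases i <;> fin_cases j <;> rfl
  rw [hz] at hg
  have h1 : (M : Matrix (Fin 3) (Fin 3) F).map (algebraMap F K) = 0 := by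
    have h2 := congrArg (fun N => (frameMat u)ᵀ⁻¹ * N * (frameMat u)⁻¹) hg
    simp only [Matrix.mul_zero, Matrix.zero_mul] at h2
    rwa [Matrix.mul_assoc, Matrix.mul_assoc, Matrix.mul_assoc, mul_nonsing_inv _ hu, Matrix.mul_one,
      ← Matrix.mul_assoc, nonsing_inv_mul _ hut, Matrix.one_mul] at h2
  ext i j
  have := congrFun (congrFun h1 i) j
  simpa using this

end IsFrame

omit [Fintype F] in
lemma exists_mat_mk (hM : M ≠ 0) : ∃ a : K, a ≠ 0 ∧
    Conic.mat K (.mk F M hM) =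
      a • (M : Matrix (Fin 3) (Fin 3) F).map (algebraMap F K) := by
  obtain ⟨a, ha⟩ := Projectivization.exists_smul_eq_mk_rep F M hM
  refine ⟨algebraMap F K a, by simp, ?_⟩
  rw [Conic.mat, ← ha]
  ext i j
  simp [Units.smul_def]

/-- The monic cubic with the roots `e i`. -/
def cubic (e : Fin 3 → K) : K[X] := ∏ i, (X - C (e i))

omit [Fintype F] [Algebra F K] in
lemma cubic_eq (e : Fin 3 → K) : cubic e = X ^ 3 + C (-(e 0 + e 1 + e 2)) * X ^ 2 +
    C (e 0 * e 1 + e 0 * e 2 + e 1 * e 2) * X + C (-(e 0 * e 1 * e 2)) := by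
  simp only [cubic, Fin.prod_univ_three, map_neg, map_add, map_mul]
  ring

lemma coeff_cubic (e : Fin 3 → K) : (cubic e).coeff 0 = -(e 0 * e 1 * e 2) ∧
    (cubic e).coeff 1 = e 0 * e 1 + e 0 * e 2 + e 1 * e 2 ∧
    (cubic e).coeff 2 = -(e 0 + e 1 + e 2) := by
  rw [cubic_eq]
  refine ⟨?_, ?_, ?_⟩ <;>
    simp only [coeff_add, coeff_C_mul, coeff_X, coeff_C, coeff_X_pow] <;> simp

lemma cubicEval_cubic (e : Fin 3 → K) (x : K) :
    cubicEval (cubic e) x = (x - e 0) * (x - e 1) * (x - e 2) := by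
  obtain ⟨h0, h1, h2⟩ := coeff_cubic e
  rw [cubicEval, h0, h1, h2]
  ring

namespace IsFrame

/-- Simultaneous standard form of two members `M`, `N + c M` of a pencil. -/
theorem isStandard (h : IsFrame P u σ) (h2 : (2 : K) ≠ 0) {N : symMatrices F} {c : F}
    {e : Fin 3 → K} (hM : M ∈ P.space) (hN : N ∈ P.space) (he : Function.Injective e)
    (hL : ∀ i, splitForm u i N = -e i * splitForm u i M) (hL0 : ∀ i, splitForm u i M ≠ 0)
    (hM0 : M ≠ 0) (hNM : N + c • M ≠ 0) :
    ∃ W : Matrix (Fin 3) (Fin 3) K, IsStandard (.mk F M hM0) (.mk F (N + c • M) hNM) W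
      (cubic e) (algebraMap F K c) := by
  have h01 : e 0 - e 1 ≠ 0 := sub_ne_zero.2 (he.ne (by decide))
  have h02 : e 0 - e 2 ≠ 0 := sub_ne_zero.2 (he.ne (by decide))
  have h12 : e 1 - e 2 ≠ 0 := sub_ne_zero.2 (he.ne (by decide))
  have hs := h.sum_splitForm h2 hM
  have hs' := h.sum_splitForm h2 hN
  simp only [hL] at hs'
  set k := splitForm u 0 M / (e 1 - e 2) with hk
  have hk0 : k ≠ 0 := div_ne_zero (hL0 0) h12
  have m0 : splitForm u 0 M = k * (e 1 - e 2) := by rw [hk, div_mul_cancel₀ _ h12]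
  -- The split forms of `M` satisfy two linear relations, `∑ Lᵢ = 0` and, from `N`, `∑ eᵢ Lᵢ = 0`.
  -- Hence they are proportional to the differences of the `e i`.
  have m1 : splitForm u 1 M = k * (e 2 - e 0) := by
    rw [hk, div_mul_eq_mul_div, eq_div_iff h12]
    linear_combination -e 2 * hs - hs'
  have m2 : splitForm u 2 M = k * (e 0 - e 1) := by
    linear_combination hs - m0 - m1
  -- The rows are the chords through pairs of parameters `e i`. So `frameMat u * S` sends the
  -- parameter `e i` to the `i`-th base point and `∞` to `u 0 + u 1 + u 2 = -u 3`, the fourth.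
  let S : Matrix (Fin 3) (Fin 3) K := !![e 1 * e 2, -(e 1 + e 2), 1; e 0 * e 2, -(e 0 + e 2), 1;
    e 0 * e 1, -(e 0 + e 1), 1]
  have hS : S.det = (e 0 - e 1) * (e 0 - e 2) * (e 1 - e 2) := by
    simp [S, det_fin_three]
    ring
  have hS0 : S.det ≠ 0 := by
    rw [hS]
    exact mul_ne_zero (mul_ne_zero h01 h02) h12
  obtain ⟨a, ha0, ha⟩ := exists_mat_mk (K := K) hM0
  obtain ⟨b, hb0, hb⟩ := exists_mat_mk (K := K) hNM
  obtain ⟨c0, c1, c2⟩ := coeff_cubic e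
  have hmul : ∀ G : Matrix (Fin 3) (Fin 3) K, (frameMat u * S)ᵀ * G * (frameMat u * S) =
      Sᵀ * ((frameMat u)ᵀ * G * frameMat u) * S := by
    intro G
    simp only [transpose_mul, Matrix.mul_assoc]
  have hNMs : N + c • M ∈ P.space := P.space.add_mem hN (P.space.smul_mem _ hM)
  have hval : ∀ i, splitForm u i (N + c • M) = (algebraMap F K c - e i) * splitForm u i M := by
    intro i
    rw [map_add, map_smul, hL, Algebra.smul_def]
    ring
  refine ⟨frameMat u * S, ?_, ⟨a * (k * S.det), ?_, ?_⟩, ⟨b * (k * S.det), ?_, ?_⟩⟩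
  · rw [det_mul]
    exact mul_ne_zero h.det_frameMat_ne_zero hS0
  · exact mul_ne_zero ha0 (mul_ne_zero hk0 hS0)
  · rw [hmul, ha, Matrix.mul_smul, Matrix.smul_mul, h.gram hM, Matrix.mul_smul, Matrix.smul_mul,
      mul_smul, hS]
    congr 1
    rw [m0, m1, m2]
    ext i j
    fin_cases i <;> fin_cases j <;>
      simp [S, veroMat, mul_apply, Fin.sum_univ_three] <;> ring
  · exact mul_ne_zero hb0 (mul_ne_zero hk0 hS0)
  · rw [hmul, hb, Matrix.mul_smul, Matrix.smul_mul, h.gram hNMs, Matrix.mul_smul, Matrix.smul_mul,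
      mul_smul, hS]
    congr 1
    rw [hval, hval, hval, m0, m1, m2]
    ext i j
    fin_cases i <;> fin_cases j <;>
      simp [S, pencilMat, mul_apply, Fin.sum_univ_three, c0, c1, c2] <;> ring

end IsFrame
end Splittings

/-! ### Torsion points and their abscissas. -/

section Counting

open Polynomial WeierstrassCurve.Affine

variable {F : Type*} [Field F] {K : Type*} [Field K] [Algebra F K] [DecidableEq K]

/-- The abscissas in `F` of the points of `E[n] ∖ E[2]`, `E : y² = f(x)`. -/
def torsionAbscissas (F : Type*) [Field F] {K : Type*} [Field K] [Algebra F K] [DecidableEq K]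
    (n : ℕ) (f : K[X]) : Set F :=
  {c | ∃ (d : K) (hQ : (cubicCurve f).toAffine.Nonsingular (algebraMap F K c) d), d ≠ 0 ∧
    n • (Point.some _ d hQ) = 0}

lemma two_nsmul_eq_zero_iff (h2 : (2 : K) ≠ 0) {f : K[X]} {c d : K}
    (hQ : (cubicCurve f).toAffine.Nonsingular c d) : 2 • Point.some c d hQ = 0 ↔ d = 0 := by
  rw [two_nsmul, add_eq_zero_iff_eq_neg, Point.neg_some, Point.some.injEq, negY_cubicCurve]
  constructor
  · rintro ⟨-, h⟩
    have : 2 * d = 0 := by linear_combination h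
    exact (mul_eq_zero.1 this).resolve_left h2
  · rintro rfl
    simp

/-- A point outside `E[2]` differs from its negative, and the two share their abscissa: this is the
source of the factor `1/2`. -/
theorem torsionCount_eq [Finite F] (h2 : (2 : K) ≠ 0) (n : ℕ) (f : K[X]) :
    torsionCount F n f = 2 * (torsionAbscissas F n f).ncard := by
  classical
  let T := torsionAbscissas F n f
  let g : T → (cubicCurve f).toAffine.Point :=
    fun c => Point.some _ c.2.choose c.2.choose_spec.choose
  have hg0 : ∀ c : T, c.2.choose ≠ 0 := fun c => c.2.choose_spec.choose_spec.1
  have hgn : ∀ c, n • g c = 0 := fun c => c.2.choose_spec.choose_spec.2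
  have hg2 : ∀ c, 2 • g c ≠ 0 := fun c h => hg0 c ((two_nsmul_eq_zero_iff h2 _).1 h)
  have hx : ∀ c, xCoord (g c) = some (algebraMap F K c) := fun c => rfl
  have hinj : Function.Injective g := by
    intro a b hab
    have := congrArg xCoord hab
    rw [hx, hx] at this
    exact Subtype.ext ((algebraMap F K).injective (Option.some.inj this))
  have hset : torsionPoints F n f = Set.range g ∪ Set.range (-g) := by
    ext P
    constructor
    · rintro ⟨hn, h2P, x, y, h, rfl⟩
      have hT : x ∈ T := ⟨y, h, fun h0 => h2P ((two_nsmul_eq_zero_iff h2 h).2 h0), hn⟩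
      rcases eq_or_eq_neg_of_xCoord_eq (R := Point.some _ y h) (S := g ⟨x, hT⟩) rfl with e | e
      · exact Or.inl ⟨_, e.symm⟩
      · exact Or.inr ⟨_, e.symm⟩
    · rintro (⟨c, rfl⟩ | ⟨c, rfl⟩)
      · exact ⟨hgn c, hg2 c, c, _, _, rfl⟩
      · refine ⟨by simp [hgn c], by simpa using hg2 c, c, _,
          (nonsingular_neg _ _).2 c.2.choose_spec.choose, Point.neg_some _⟩
  have hdisj : Disjoint (Set.range g) (Set.range (-g)) := by
    rw [Set.disjoint_left]
    rintro _ ⟨a, rfl⟩ ⟨b, hb⟩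
    have hb' : -g b = g a := hb
    have := congrArg xCoord hb'
    rw [xCoord_neg, hx, hx] at this
    have hab : b = a := Subtype.ext ((algebraMap F K).injective (Option.some.inj this))
    apply hg2 a
    rw [hab] at hb'
    rw [two_nsmul]
    nth_rw 1 [← hb']
    exact neg_add_cancel _
  have h₁ : (Set.range g).ncard = T.ncard := by
    rw [← Set.image_univ, Set.ncard_image_of_injective _ hinj, Set.ncard_univ]
    rfl
  have h₂ : (Set.range (-g)).ncard = T.ncard := by
    rw [← Set.image_univ, Set.ncard_image_of_injective _
      (show Function.Injective (-g) from neg_injective.comp hinj), Set.ncard_univ]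
    rfl
  rw [torsionCount, hset, Set.ncard_union_eq hdisj (Set.finite_range _) (Set.finite_range _), h₁,
    h₂, two_mul]

lemma nonsingular_cubic (h2 : (2 : K) ≠ 0) {e : Fin 3 → K} (he : Function.Injective e) {x y : K}
    (h : y ^ 2 = cubicEval (cubic e) x) : (cubicCurve (cubic e)).toAffine.Nonsingular x y := by
  by_cases hy : y = 0
  · subst hy
    have h01 : e 0 - e 1 ≠ 0 := sub_ne_zero.2 (he.ne (by decide))
    have h02 : e 0 - e 2 ≠ 0 := sub_ne_zero.2 (he.ne (by decide))
    have h12 : e 1 - e 2 ≠ 0 := sub_ne_zero.2 (he.ne (by decide))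
    rw [WeierstrassCurve.Affine.nonsingular_iff]
    refine ⟨equation_cubicCurve.2 h, Or.inl ?_⟩
    obtain ⟨-, c1, c2⟩ := coeff_cubic e
    simp only [cubicCurve, c1, c2]
    rw [cubicEval_cubic, zero_pow two_ne_zero, eq_comm, mul_eq_zero, mul_eq_zero, sub_eq_zero,
      sub_eq_zero, sub_eq_zero] at h
    intro h'
    rcases h with (rfl | rfl) | rfl
    · exact mul_ne_zero h01 h02 (by linear_combination -h')
    · exact mul_ne_zero h01 h12 (by linear_combination h')
    · exact mul_ne_zero h02 h12 (by linear_combination -h')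
  · exact nonsingular_cubicCurve_of_ne_zero h2 h hy

end Counting

/-! ### Two-dimensional linear algebra. -/

section LinearAlgebra

variable {F V : Type*} [Field F] [AddCommGroup V] [Module F V]

lemma exists_eq_of_finrank_eq_two {S : Submodule F V} (hS : Module.finrank F S = 2) {M N R : V}
    (hM : M ∈ S) (hN : N ∈ S) (h : ∀ x y : F, x • M + y • N = 0 → x = 0 ∧ y = 0) (hR : R ∈ S) :
    ∃ x y : F, R = x • M + y • N := by
  have hli : LinearIndependent F ![(⟨M, hM⟩ : S), ⟨N, hN⟩] := by
    rw [LinearIndependent.pair_iff]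
    intro s t hst
    exact h s t (congrArg Subtype.val hst)
  have := Module.finite_of_finrank_eq_succ hS
  have hspan := hli.span_eq_top_of_card_eq_finrank' (by rw [hS]; rfl)
  have hmem : (⟨R, hR⟩ : S) ∈ Submodule.span F (Set.range ![(⟨M, hM⟩ : S), ⟨N, hN⟩]) := by
    rw [hspan]
    trivial
  rw [Matrix.range_cons, Matrix.range_cons, Matrix.range_empty, Set.union_empty,
    Set.singleton_union, Submodule.mem_span_pair] at hmem
  obtain ⟨x, y, hxy⟩ := hmem
  exact ⟨x, y, (congrArg Subtype.val hxy).symm⟩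

lemma relation_of_smul_add_eq {M N : V} {a b k : F} (h : k • (N + b • M) = N + a • M) :
    (k * b - a) • M + (k - 1) • N = 0 := by
  rw [← sub_eq_zero] at h
  rw [← h]
  module

end LinearAlgebra

/-! ### Counting Poncelet pairs by their first conic. -/

section PairCount

open Polynomial WeierstrassCurve.Affine

variable {F : Type*} [Field F] [Fintype F] {K : Type*} [Field K] [Algebra F K] [DecidableEq K]
  {P : Pencil F} {u : Fin 4 → Fin 3 → K} {σ : Equiv.Perm (Fin 4)} {M N : symMatrices F}
  {e : Fin 3 → K}

/-- A smooth member `M` of a pencil, with a second member `N` such that the parameters `c` of the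
degenerate members `N + c M` are the `e i`. -/
structure IsAffineChart (P : Pencil F) (u : Fin 4 → Fin 3 → K)
    (M N : symMatrices F) (e : Fin 3 → K) : Prop where
  fst_mem : M ∈ P.space
  snd_mem : N ∈ P.space
  injective : Function.Injective e
  fst_ne_zero : ∀ i, splitForm u i M ≠ 0
  snd_eq : ∀ i, splitForm u i N = -e i * splitForm u i M

omit [Fintype F] [DecidableEq K]

/-- The ratios `-e i` of the split forms of `N` to those of `M` are distinct, so `M` and `N` are
independent. -/
lemma IsAffineChart.eq_zero (hc : IsAffineChart P u M N e) {x y : F}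
    (h : x • M + y • N = 0) : x = 0 ∧ y = 0 := by
  have key : ∀ i, algebraMap F K x = algebraMap F K y * e i := by
    intro i
    have := congrArg (splitForm u i) h
    rw [map_add, map_smul, map_smul, hc.snd_eq, map_zero, Algebra.smul_def, Algebra.smul_def]
      at this
    have h' : splitForm u i M * (algebraMap F K x - algebraMap F K y * e i) = 0 := by
      linear_combination this
    exact sub_eq_zero.1 ((mul_eq_zero.1 h').resolve_left (hc.fst_ne_zero i))
  have hy : y = 0 := by
    have h' : algebraMap F K y * (e 0 - e 1) = 0 := by linear_combination key 1 - key 0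
    have := (mul_eq_zero.1 h').resolve_right (sub_ne_zero.2 (hc.injective.ne (by decide)))
    simpa using this
  refine ⟨?_, hy⟩
  simpa [hy] using key 0

lemma IsAffineChart.exists_eq (hc : IsAffineChart P u M N e) {R : symMatrices F}
    (hR : R ∈ P.space) : ∃ x y : F, R = x • M + y • N := by
  exact exists_eq_of_finrank_eq_two P.finrank_eq hc.fst_mem hc.snd_mem (fun x y => hc.eq_zero) hR

lemma IsAffineChart.fst_ne (hc : IsAffineChart P u M N e) : M ≠ 0 := by
  rintro rfl
  exact hc.fst_ne_zero 0 (map_zero _)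

lemma IsAffineChart.add_ne (hc : IsAffineChart P u M N e) (c : F) :
    N + c • M ≠ 0 := by
  intro h
  have := hc.eq_zero (x := c) (y := 1) (by rw [one_smul, add_comm, h])
  exact one_ne_zero this.2

lemma IsAffineChart.splitForm_add (hc : IsAffineChart P u M N e) (c : F)
    (i : Fin 3) : splitForm u i (N + c • M) = (algebraMap F K c - e i) * splitForm u i M := by
  rw [map_add, map_smul, hc.snd_eq, Algebra.smul_def]
  ring

lemma isSmooth_mk (hM0 : M ≠ 0) : Conic.IsSmooth K (.mk F M hM0) ↔
    ((M : Matrix (Fin 3) (Fin 3) F).map (algebraMap F K)).det ≠ 0 := by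
  obtain ⟨a, ha0, ha⟩ := exists_mat_mk (K := K) hM0
  rw [isSmooth_iff_det_ne_zero, ha, Matrix.det_smul]
  simp [ha0]

/-- Two distinct members span the pencil, so transversality is automatic once the base locus has
four points. -/
lemma IsAffineChart.inter_points (hc : IsAffineChart P u M N e) (c : F) :
    Conic.points K (.mk F M hc.fst_ne) ∩ Conic.points K (.mk F (N + c • M) (hc.add_ne c)) =
      P.basePoints K := by
  ext X
  constructor
  · rintro ⟨h₁, h₂⟩
    rw [← X.mk_rep, mk_mem_basePoints]
    have h₁' : bil M X.rep X.rep = 0 := (bil_rep_mk hc.fst_ne).1 h₁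
    have h₂' : bil (N + c • M) X.rep X.rep = 0 := (bil_rep_mk (hc.add_ne c)).1 h₂
    rw [bil_add, bil_smul, h₁', mul_zero, add_zero] at h₂'
    intro R hR
    obtain ⟨x, y, rfl⟩ := hc.exists_eq hR
    rw [bil_add, bil_smul, bil_smul, h₁', h₂', mul_zero, mul_zero, add_zero]
  · intro h
    exact ⟨h _ ((mk_mem_members _).2 hc.fst_mem), h _ ((mk_mem_members _).2
      (P.space.add_mem hc.snd_mem (P.space.smul_mem _ hc.fst_mem)))⟩

variable [Fintype F] [DecidableEq K] [IsAlgClosed K]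

namespace IsFrame

/-- The partner `N + c • M` is smooth when `c` avoids the roots `e i`, and closure means `n • Q = 0`
for a point `Q` above `c`. The remaining member `M` is excluded by transversality, as it meets
itself in infinitely many points. -/
theorem ncard_partners (h : IsFrame P u σ) (h2 : (2 : K) ≠ 0) (hP : (P.basePoints K).ncard = 4)
    (hc : IsAffineChart P u M N e) (n : ℕ) :
    {B : Conic F | (.mk F M hc.fst_ne, B) ∈ P.ponceletPairs K n}.ncard =
      (torsionAbscissas F n (cubic e)).ncard := by
  have : Infinite K := IsAlgClosed.instInfinite
  have hmem : ∀ c : F, N + c • M ∈ P.space := fun c =>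
    P.space.add_mem hc.snd_mem (P.space.smul_mem _ hc.fst_mem)
  have hstd := fun c => h.isStandard h2 (c := c) hc.fst_mem hc.snd_mem hc.injective hc.snd_eq
    hc.fst_ne_zero hc.fst_ne (hc.add_ne c)
  have hf : ∀ x : K, (∃ y : K, y ^ 2 = cubicEval (cubic e) x ∧
      (cubicCurve (cubic e)).toAffine.Nonsingular x y) := by
    intro x
    obtain ⟨y, hy⟩ := IsAlgClosed.exists_pow_nat_eq (cubicEval (cubic e) x) two_pos
    exact ⟨y, hy, nonsingular_cubic h2 hc.injective hy⟩
  have hself : ¬ Transversal K (.mk F M hc.fst_ne : Conic F) (.mk F M hc.fst_ne) := by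
    intro ht
    obtain ⟨W, hW⟩ := hstd 0
    rw [Transversal, Set.inter_self] at ht
    have hfin := Set.finite_of_ncard_pos (by rw [ht]; norm_num)
    exact Set.infinite_of_injective_forall_mem hW.pt_injective hW.pt_mem hfin
  let φ : F → Conic F := fun c => .mk F (N + c • M) (hc.add_ne c)
  have hφ : Function.Injective φ := by
    intro a b hab
    obtain ⟨k, hk⟩ := (Projectivization.mk_eq_mk_iff' F _ _ _ _).1 hab
    obtain ⟨h₁, h₂⟩ := hc.eq_zero (relation_of_smul_add_eq hk)
    rw [sub_eq_zero.1 h₂, one_mul] at h₁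
    exact (sub_eq_zero.1 h₁).symm
  rw [← Set.ncard_image_of_injective _ hφ]
  congr 1
  ext B
  constructor
  · rintro ⟨-, hB, -, hBs, hT, hpon⟩
    simp only at hB hBs hT hpon
    obtain ⟨x, y, hxy⟩ := hc.exists_eq hB
    by_cases hy : y = 0
    · exfalso
      have hBM : B = .mk F M hc.fst_ne := by
        rw [← B.mk_rep, Projectivization.mk_eq_mk_iff']
        exact ⟨x, by rw [hxy, hy, zero_smul, add_zero]⟩
      rw [hBM] at hT
      exact hself hT
    · have hBφ : B = φ (x / y) := by
        rw [← B.mk_rep, Projectivization.mk_eq_mk_iff']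
        refine ⟨y, ?_⟩
        rw [hxy, smul_add, smul_smul, mul_div_cancel₀ _ hy, add_comm]
      refine ⟨x / y, ?_, hBφ.symm⟩
      rw [hBφ] at hBs hpon
      rw [isSmooth_mk, h.det_ne_zero_iff h2 (hmem _)] at hBs
      have hne : ∀ i, algebraMap F K (x / y) - e i ≠ 0 := fun i =>
        left_ne_zero_of_mul (hc.splitForm_add (x / y) i ▸ hBs i)
      obtain ⟨d, hd, hQ⟩ := hf (algebraMap F K (x / y))
      have hd0 : d ≠ 0 := by
        rintro rfl
        rw [cubicEval_cubic, zero_pow two_ne_zero] at hd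
        exact mul_ne_zero (mul_ne_zero (hne 0) (hne 1)) (hne 2) hd.symm
      obtain ⟨W, hW⟩ := hstd (x / y)
      exact ⟨d, hQ, hd0, (hW.ponceletCondition_iff h2 hd0 hQ hf n).1 hpon⟩
  · rintro ⟨c, ⟨d, hQ, hd0, hn⟩, rfl⟩
    obtain ⟨W, hW⟩ := hstd c
    refine ⟨(mk_mem_members _).2 hc.fst_mem, (mk_mem_members _).2 (hmem c), ?_, ?_, ?_,
      (hW.ponceletCondition_iff h2 hd0 hQ hf n).2 hn⟩
    · exact (isSmooth_mk _).2 ((h.det_ne_zero_iff h2 hc.fst_mem).2 hc.fst_ne_zero)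
    · refine (isSmooth_mk _).2 ((h.det_ne_zero_iff h2 (hmem c)).2 fun i => ?_)
      rw [hc.splitForm_add]
      refine mul_ne_zero ?_ (hc.fst_ne_zero i)
      have h0 := cubicEval_ne_zero hd0 hQ
      rw [cubicEval_cubic] at h0
      fin_cases i
      · exact left_ne_zero_of_mul (left_ne_zero_of_mul h0)
      · exact right_ne_zero_of_mul (left_ne_zero_of_mul h0)
      · exact right_ne_zero_of_mul h0
    · rw [Transversal, hc.inter_points, hP]

/-- The pairs are counted by charts at the smooth members of the pencil. -/
theorem ncard_ponceletPairs (h : IsFrame P u σ) (h2 : (2 : K) ≠ 0)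
    (hP : (P.basePoints K).ncard = 4) {Λ : Type*} [Fintype Λ] {M N : Λ → symMatrices F}
    {e : Λ → Fin 3 → K} (hc : ∀ l, IsAffineChart P u (M l) (N l) (e l))
    (hinj : ∀ l l' (a : F), a • M l = M l' → l = l')
    (hsurj : ∀ R ∈ P.space, (∀ i, splitForm u i R ≠ 0) → ∃ l, ∃ a : F, a • M l = R) (n : ℕ) :
    ((P.ponceletPairs K n).ncard : ℚ) = 1 / 2 * ∑ l, (torsionCount F n (cubic (e l)) : ℚ) := by
  classical
  let A : Λ → Conic F := fun l => .mk F (M l) (hc l).fst_ne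
  have hA : Function.Injective A := by
    intro l l' hl
    obtain ⟨a, ha⟩ := (Projectivization.mk_eq_mk_iff' F _ _ _ _).1 hl
    exact (hinj _ _ a ha).symm
  -- The pairs are fibred over their first conic; by `hsurj` and `hinj` every smooth member carries
  -- exactly one chart.
  have hset : P.ponceletPairs K n =
      ⋃ l, (fun B => (A l, B)) '' {B | (A l, B) ∈ P.ponceletPairs K n} := by
    ext ⟨C, B⟩
    simp only [Set.mem_iUnion]
    constructor
    · intro hCB
      have hC : C.rep ∈ P.space := hCB.1
      have hCs : Conic.IsSmooth K C := hCB.2.2.1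
      rw [isSmooth_iff_det_ne_zero, Conic.mat, h.det_ne_zero_iff h2 hC] at hCs
      obtain ⟨l, a, ha⟩ := hsurj _ hC hCs
      have hCA : C = A l := by
        rw [← C.mk_rep, Projectivization.mk_eq_mk_iff']
        exact ⟨a, ha⟩
      subst hCA
      exact ⟨l, B, hCB, rfl⟩
    · rintro ⟨l, B', hB', he⟩
      rw [← he]
      exact hB'
  have hncard : (P.ponceletPairs K n).ncard =
      ∑ l, {B | (A l, B) ∈ P.ponceletPairs K n}.ncard := by
    have : Finite (Conic F) := Quotient.finite _
    conv_lhs => rw [hset]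
    rw [Set.ncard_iUnion_of_finite (fun l => Set.toFinite _), finsum_eq_sum_of_fintype]
    · refine Finset.sum_congr rfl fun l _ => ?_
      exact Set.ncard_image_of_injective _ fun B B' hB => congrArg Prod.snd hB
    · intro l l' hll
      rw [Function.onFun, Set.disjoint_left]
      rintro _ ⟨B, -, rfl⟩ ⟨B', -, hB'⟩
      exact hll (hA (congrArg Prod.fst hB').symm)
  rw [hncard, Nat.cast_sum, Finset.mul_sum]
  refine Finset.sum_congr rfl fun l _ => ?_
  rw [h.ncard_partners h2 hP (hc l), torsionCount_eq h2]
  push_cast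
  ring

end IsFrame
end PairCount

/-! ### The action on splittings: from `S₄` to `S₃`. -/

section CycleTypes

open Equiv

lemma cycleType_eq_filter {σ : Perm (Fin 4)} {μ : Multiset ℕ} (h : σ.partition.parts = μ) :
    σ.cycleType = μ.filter (2 ≤ ·) := by
  rw [← h, Perm.filter_parts_partition_eq_cycleType]

/-- These types form the Klein four-group, the kernel of the action, singled out by `σ ^ 2 = 1` and
even sign. -/
lemma splitting_of_trivial {σ : Perm (Fin 4)}
    (h : σ.partition.parts = {1, 1, 1, 1} ∨ σ.partition.parts = {2, 2}) :
    ∀ a b, a ≠ b → splitting (σ a) (σ b) = splitting a b := by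
  have key : ∀ σ : Perm (Fin 4), σ ^ 2 = 1 → Perm.sign σ = 1 →
      ∀ a b, a ≠ b → splitting (σ a) (σ b) = splitting a b := by decide
  rcases h with h | h <;> have hc := cycleType_eq_filter h
  · have h1 : σ = 1 := Perm.cycleType_eq_zero.1 (hc.trans (by decide))
    exact key σ (by rw [h1, one_pow]) (by rw [h1, Perm.sign_one])
  · have hc' : σ.cycleType = {2, 2} := hc.trans (by decide)
    refine key σ ?_ ?_
    · rw [← orderOf_dvd_iff_pow_eq_one, ← Perm.lcm_cycleType, hc']
      decide
    · rw [Perm.sign_of_cycleType, hc']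
      decide

/-- Odd permutations act on the splittings as transpositions, which are all conjugate. -/
lemma splitting_of_odd {σ : Perm (Fin 4)}
    (h : σ.partition.parts = {2, 1, 1} ∨ σ.partition.parts = {4}) :
    ∃ π : Perm (Fin 4), ∀ a b, a ≠ b → splitting ((π⁻¹ * σ * π) a) ((π⁻¹ * σ * π) b) =
      swap 1 2 (splitting a b) := by
  have key : ∀ σ : Perm (Fin 4), Perm.sign σ = -1 → ∃ π : Perm (Fin 4), ∀ a b, a ≠ b →
      splitting ((π⁻¹ * σ * π) a) ((π⁻¹ * σ * π) b) = swap 1 2 (splitting a b) := by decide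
  apply key
  rcases h with h | h <;> have hc := cycleType_eq_filter h
  · rw [Perm.sign_of_cycleType, hc]
    decide
  · rw [Perm.sign_of_cycleType, hc]
    decide

lemma splitting_of_threeCycle {σ : Perm (Fin 4)} (h : σ.partition.parts = {3, 1}) :
    ∃ π : Perm (Fin 4), ∀ a b, a ≠ b → splitting ((π⁻¹ * σ * π) a) ((π⁻¹ * σ * π) b) =
      splitting a b + 1 := by
  have key : ∀ σ : Perm (Fin 4), σ ^ 3 = 1 → σ ≠ 1 → ∃ π : Perm (Fin 4), ∀ a b, a ≠ b →
      splitting ((π⁻¹ * σ * π) a) ((π⁻¹ * σ * π) b) = splitting a b + 1 := by decide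
  have hc : σ.cycleType = {3} := (cycleType_eq_filter h).trans (by decide)
  refine key σ ?_ ?_
  · rw [← orderOf_dvd_iff_pow_eq_one, ← Perm.lcm_cycleType, hc]
    decide
  · rintro rfl
    simp at hc

end CycleTypes

/-! ### Elements fixed by Frobenius. -/

section Rationality

variable {F : Type*} [Field F] [Fintype F] {K : Type*} [Field K] [Algebra F K]

/-- The `q` elements of `F` already exhaust the roots of `X ^ q - X`. -/
lemma mem_range_of_pow_card_eq {x : K} (hx : x ^ Fintype.card F = x) :
    ∃ a : F, algebraMap F K a = x := by
  classical
  have h := FiniteField.X_pow_card_sub_X_ne_zero K (Fintype.one_lt_card (α := F))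
  by_contra hne
  push Not at hne
  let s : Finset K := insert x (Finset.univ.image (algebraMap F K))
  have hs : s.card = Fintype.card F + 1 := by
    rw [Finset.card_insert_of_notMem (by simpa using hne),
      Finset.card_image_of_injective _ (algebraMap F K).injective, Finset.card_univ]
  have hroot : s ⊆ (Polynomial.X ^ Fintype.card F - Polynomial.X : Polynomial K).roots.toFinset := by
    intro y hy
    rw [Multiset.mem_toFinset, Polynomial.mem_roots h, Polynomial.IsRoot.def, Polynomial.eval_sub,
      Polynomial.eval_pow, Polynomial.eval_X, sub_eq_zero]
    rcases Finset.mem_insert.1 hy with rfl | hy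
    · exact hx
    · obtain ⟨a, -, rfl⟩ := Finset.mem_image.1 hy
      rw [← map_pow, FiniteField.pow_card]
  have h₁ := Finset.card_le_card hroot
  have h₂ := Multiset.toFinset_card_le
    (Polynomial.X ^ Fintype.card F - Polynomial.X : Polynomial K).roots
  have h₃ := Polynomial.card_roots' (Polynomial.X ^ Fintype.card F - Polynomial.X : Polynomial K)
  rw [FiniteField.X_pow_card_sub_X_natDegree_eq K (Fintype.one_lt_card (α := F))] at h₃
  omega

lemma frob_add (x y : K) : (x + y) ^ Fintype.card F = x ^ Fintype.card F + y ^ Fintype.card F :=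
  map_add (FiniteField.frobeniusAlgHom F K) x y

lemma frob_sub (x y : K) : (x - y) ^ Fintype.card F = x ^ Fintype.card F - y ^ Fintype.card F :=
  map_sub (FiniteField.frobeniusAlgHom F K) x y

end Rationality

/-! ### Rational coordinates on a pencil. -/

section Coordinates

variable {F : Type*} [Field F] [Fintype F] {K : Type*} [Field K] [Algebra F K]
  {P : Pencil F} {u : Fin 4 → Fin 3 → K} {σ : Equiv.Perm (Fin 4)}

namespace IsFrame

lemma splitForm_injective (h : IsFrame P u σ) {M N : symMatrices F} (hM : M ∈ P.space)
    (hN : N ∈ P.space) (he : ∀ i, splitForm u i M = splitForm u i N) : M = N := by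
  rw [← sub_eq_zero]
  exact h.eq_zero_of_splitForm (P.space.sub_mem hM hN) fun i => by rw [map_sub, he, sub_self]

/-- Split forms determine a member, so the coordinate map to `F × F` is injective; both sides have
`q²` elements, so it is onto. -/
lemma exists_member (h : IsFrame P u σ) {α β : Fin 3 → K}
    (H : ∀ M ∈ P.space, ∃ v : F × F, ∀ i, splitForm u i M =
      α i * algebraMap F K v.1 + β i * algebraMap F K v.2) (v : F × F) :
    ∃ M ∈ P.space, ∀ i, splitForm u i M = α i * algebraMap F K v.1 + β i * algebraMap F K v.2 := by
  classical
  choose! φ hφ using H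
  have : Fintype P.space := Fintype.ofFinite _
  have hbij : Function.Bijective fun M : P.space => φ M := by
    rw [Fintype.bijective_iff_injective_and_card]
    refine ⟨fun M N hMN => Subtype.ext (h.splitForm_injective M.2 N.2 fun i => ?_), ?_⟩
    · rw [hφ M M.2, hφ N N.2]
      simp only at hMN
      rw [hMN]
    · rw [Module.card_eq_pow_finrank (K := F), P.finrank_eq, Fintype.card_prod, sq]
  obtain ⟨M, hM⟩ := hbij.2 v
  refine ⟨M, M.2, fun i => ?_⟩
  rw [hφ M M.2]
  simp only at hM
  rw [hM]

/-- The Poncelet pairs are counted by charts given in linear coordinates on the pencil. -/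
theorem ncard_ponceletPairs_of_coordinates [DecidableEq K] [IsAlgClosed K] (h : IsFrame P u σ)
    (h2 : (2 : K) ≠ 0)
    (hP : (P.basePoints K).ncard = 4) {α β : Fin 3 → K}
    (H : ∀ M ∈ P.space, ∃ v : F × F, ∀ i, splitForm u i M =
      α i * algebraMap F K v.1 + β i * algebraMap F K v.2)
    (hind : ∀ v : F × F, (∀ i, α i * algebraMap F K v.1 + β i * algebraMap F K v.2 = 0) → v = 0)
    {Λ : Type*} [Fintype Λ] (m m' : Λ → F × F) (e : Λ → Fin 3 → K)
    (he : ∀ l, Function.Injective (e l))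
    (hne : ∀ l i, α i * algebraMap F K (m l).1 + β i * algebraMap F K (m l).2 ≠ 0)
    (hrel : ∀ l i, α i * algebraMap F K (m' l).1 + β i * algebraMap F K (m' l).2 =
      -e l i * (α i * algebraMap F K (m l).1 + β i * algebraMap F K (m l).2))
    (hinj : ∀ l l' (a : F), a • m l = m l' → l = l')
    (hsurj : ∀ v : F × F, (∀ i, α i * algebraMap F K v.1 + β i * algebraMap F K v.2 ≠ 0) →
      ∃ l, ∃ a : F, a • m l = v) (n : ℕ) :
    ((P.ponceletPairs K n).ncard : ℚ) = 1 / 2 * ∑ l, (torsionCount F n (cubic (e l)) : ℚ) := by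
  choose M hM hML using fun l => h.exists_member H (m l)
  choose N hN hNL using fun l => h.exists_member H (m' l)
  refine h.ncard_ponceletPairs h2 hP (M := M) (N := N) (fun l => ⟨hM l, hN l, he l, ?_, ?_⟩) ?_ ?_ n
  · intro i
    rw [hML]
    exact hne l i
  · intro i
    rw [hML, hNL]
    exact hrel l i
  · intro l l' a hl
    refine hinj l l' a (sub_eq_zero.1 (hind _ fun i => ?_))
    have := congrArg (splitForm u i) hl
    rw [map_smul, Algebra.smul_def, hML, hML] at this
    simp only [Prod.fst_sub, Prod.snd_sub, Prod.smul_fst, Prod.smul_snd, smul_eq_mul, map_sub,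
      map_mul]
    linear_combination this
  · intro R hR hRs
    obtain ⟨v, hv⟩ := H R hR
    obtain ⟨l, a, rfl⟩ := hsurj v fun i => hv i ▸ hRs i
    refine ⟨l, a, h.splitForm_injective (P.space.smul_mem _ (hM l)) hR fun i => ?_⟩
    rw [map_smul, Algebra.smul_def, hML, hv]
    simp only [Prod.smul_fst, Prod.smul_snd, smul_eq_mul, map_mul]
    ring

end IsFrame
end Coordinates

/-! ### The three families of elliptic curves. -/

section Families

open Polynomial

variable {F : Type*} [Field F] [Fintype F] {K : Type*} [Field K] [Algebra F K]
  {P : Pencil F} {u : Fin 4 → Fin 3 → K} {σ : Equiv.Perm (Fin 4)}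

omit [Fintype F] [Algebra F K] [Field F] [Field K] in
lemma injective_vec_three {a b c : K} (hab : a ≠ b) (hac : a ≠ c) (hbc : b ≠ c) :
    Function.Injective ![a, b, c] := by
  intro i j hij
  fin_cases i <;> fin_cases j <;>
    first
    | rfl
    | exact absurd hij hab
    | exact absurd hij hac
    | exact absurd hij hbc
    | exact absurd hij.symm hab
    | exact absurd hij.symm hac
    | exact absurd hij.symm hbc

namespace IsFrame

lemma splitForm_pow (h : IsFrame P u σ) (h2 : (2 : K) ≠ 0) {τ : Fin 3 → Fin 3}
    (hτ : ∀ a b, a ≠ b → splitting (σ a) (σ b) = τ (splitting a b)) {M : symMatrices F}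
    (hM : M ∈ P.space) (i : Fin 3) :
    splitForm u i M ^ Fintype.card F = splitForm u (τ i) M := by
  obtain ⟨a, b, hab, rfl⟩ : ∃ a b : Fin 4, a ≠ b ∧ splitting a b = i := by
    revert i
    decide
  rw [h.splitForm_pow_card h2 hM hab, hτ a b hab]

variable [DecidableEq K] [IsAlgClosed K]

/-- All three degenerate members are rational. -/
theorem ncard_of_trivial [DecidableEq F] (h : IsFrame P u σ) (h2 : (2 : K) ≠ 0)
    (hP : (P.basePoints K).ncard = 4)
    (hσ : ∀ a b, a ≠ b → splitting (σ a) (σ b) = splitting a b) (n : ℕ) :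
    ((P.ponceletPairs K n).ncard : ℚ) = 1 / 2 * ∑ l : {l : F // l ≠ 0 ∧ l ≠ 1},
      (torsionCount F n (cubic ![0, algebraMap F K l, 1]) : ℚ) := by
  have hr : ∀ i, ∀ M ∈ P.space, ∃ a : F, algebraMap F K a = splitForm u i M := fun i M hM =>
    mem_range_of_pow_card_eq (h.splitForm_pow h2 (τ := id) hσ hM i)
  have hα : ∀ (v : F × F) (i : Fin 3), (![1, 0, -1] : Fin 3 → K) i * algebraMap F K v.1 +
      (![0, -1, 1] : Fin 3 → K) i * algebraMap F K v.2 =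
      algebraMap F K ((![v.1, -v.2, v.2 - v.1] : Fin 3 → F) i) := by
    intro v i
    fin_cases i <;> simp
    ring
  -- The split forms are `(v₁, -v₂, v₂ - v₁)`. At `M = (1 - l, 1)` they are `(1 - l, -1, l)`, and at
  -- `N = (0, -l)` they are `(0, l, -l)`, so the roots are `0, l, 1`. The values `l = 0, 1` and the
  -- point `(1, 0)` are the degenerate members.
  refine h.ncard_ponceletPairs_of_coordinates h2 hP (α := ![1, 0, -1]) (β := ![0, -1, 1]) ?_ ?_
    (Λ := {l : F // l ≠ 0 ∧ l ≠ 1}) (fun l => (1 - l, 1)) (fun l => (0, -l))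
    (fun l => ![0, algebraMap F K l, 1]) ?_ ?_ ?_ ?_ ?_ n
  · intro M hM
    obtain ⟨a, ha⟩ := hr 0 M hM
    obtain ⟨b, hb⟩ := hr 1 M hM
    refine ⟨(a, -b), fun i => ?_⟩
    have hs := h.sum_splitForm h2 hM
    rw [hα]
    fin_cases i
    · simp [ha]
    · simp [hb]
    · simp only [Fin.reduceFinMk, Matrix.cons_val, map_sub, map_neg, ha, hb]
      linear_combination hs
  · intro v hv
    simp only [hα, map_eq_zero] at hv
    have h0 := hv 0
    have h1 := hv 1
    simp at h0 h1
    exact Prod.ext h0 h1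
  · rintro ⟨l, hl0, hl1⟩
    refine injective_vec_three (Ne.symm ?_) zero_ne_one ?_
    · simpa using hl0
    · simpa using hl1
  · rintro ⟨l, hl0, hl1⟩ i
    rw [hα, ne_eq, map_eq_zero]
    fin_cases i
    · simpa [sub_eq_zero] using hl1.symm
    · simp
    · simpa using hl0
  · rintro ⟨l, hl0, hl1⟩ i
    rw [hα, hα]
    fin_cases i <;> simp
  · rintro ⟨l, hl⟩ ⟨l', hl'⟩ a hal
    have e1 := congrArg Prod.fst hal
    have e2 := congrArg Prod.snd hal
    simp at e1 e2
    rw [e2] at e1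
    simpa using e1
  · rintro ⟨x, y⟩ hv
    have hv' : ∀ i, (![x, -y, y - x] : Fin 3 → F) i ≠ 0 := fun i h0 => hv i (by
      rw [hα, h0, map_zero])
    have hx : x ≠ 0 := hv' 0
    have hy : y ≠ 0 := neg_ne_zero.1 (hv' 1)
    have hyx : y - x ≠ 0 := hv' 2
    refine ⟨⟨1 - x / y, ?_, ?_⟩, y, ?_⟩
    · intro h0
      rw [sub_eq_zero, eq_comm, div_eq_one_iff_eq hy] at h0
      exact hyx (sub_eq_zero.2 h0.symm)
    · simp [hx, hy]
    · ext
      · simp only [Prod.smul_fst, smul_eq_mul]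
        field_simp
        ring
      · simp

/-- Exactly one degenerate member is rational. -/
theorem ncard_of_swap (h : IsFrame P u σ) (h2 : (2 : K) ≠ 0)
    (hP : (P.basePoints K).ncard = 4)
    (hσ : ∀ a b, a ≠ b → splitting (σ a) (σ b) = Equiv.swap 1 2 (splitting a b)) (n : ℕ) {b : F}
    (hb : ¬ IsSquare b) {β : K} (hβ : β ^ 2 = algebraMap F K b) :
    ((P.ponceletPairs K n).ncard : ℚ) = 1 / 2 * ∑ l : F,
      (torsionCount F n (cubic ![algebraMap F K l, -β, β]) : ℚ) := by
  have hβF : ∀ a : F, algebraMap F K a ≠ β := by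
    rintro a rfl
    refine hb ⟨a, (algebraMap F K).injective ?_⟩
    rw [← hβ, map_mul, sq]
  have hβ0 : β ≠ 0 := fun h0 => hβF 0 (by rw [h0, map_zero])
  have hβF' : ∀ a : F, algebraMap F K a ≠ -β := by
    intro a ha
    exact hβF (-a) (by rw [map_neg, ha, neg_neg])
  have hββ : -β ≠ β := by
    intro h'
    exact mul_ne_zero h2 hβ0 (by linear_combination -h')
  have hfrob : β ^ Fintype.card F = -β := by
    have : (β ^ Fintype.card F) ^ 2 = β ^ 2 := by
      rw [← pow_mul, mul_comm, pow_mul, hβ, ← map_pow, FiniteField.pow_card]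
    rcases sq_eq_sq_iff_eq_or_eq_neg.1 this with h' | h'
    · obtain ⟨a, ha⟩ := mem_range_of_pow_card_eq h'
      exact absurd ha (hβF a)
    · exact h'
  have h2β : 2 * β ≠ 0 := mul_ne_zero h2 hβ0
  -- The coordinates are `y = L₀` and `x = β (L₁ - L₂)`. Both are rational, since Frobenius
  -- exchanges `L₁`, `L₂` and negates `β`. The degenerate members are `y = 0` and the conjugate `x =
  -- ±βy`, so the smooth ones are the `(l, 1)` with `l` in `F`.
  refine h.ncard_ponceletPairs_of_coordinates h2 hP (α := ![0, 1 / (2 * β), -1 / (2 * β)])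
    (β := ![1, -1 / 2, -1 / 2]) ?_ ?_
    (fun l : F => (l, 1)) (fun l => (-b, -l)) (fun l => ![algebraMap F K l, -β, β]) ?_ ?_ ?_ ?_ ?_ n
  · intro M hM
    have hs := h.sum_splitForm h2 hM
    have f0 := h.splitForm_pow h2 hσ hM 0
    have f1 := h.splitForm_pow h2 hσ hM 1
    have f2 := h.splitForm_pow h2 hσ hM 2
    rw [show Equiv.swap (1 : Fin 3) 2 0 = 0 by decide] at f0
    rw [show Equiv.swap (1 : Fin 3) 2 1 = 2 by decide] at f1
    rw [show Equiv.swap (1 : Fin 3) 2 2 = 1 by decide] at f2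
    obtain ⟨y, hy⟩ := mem_range_of_pow_card_eq f0
    obtain ⟨x, hx⟩ := mem_range_of_pow_card_eq (F := F)
      (x := β * (splitForm u 1 M - splitForm u 2 M))
      (by rw [mul_pow, frob_sub, hfrob, f1, f2]; ring)
    refine ⟨(x, y), fun i => ?_⟩
    simp only [hx, hy]
    fin_cases i
    · simp
    · simp only [Fin.mk_one, Matrix.cons_val]
      field_simp
      linear_combination hs
    · simp only [Fin.reduceFinMk, Matrix.cons_val]
      field_simp
      linear_combination hs
  · rintro ⟨x, y⟩ hv
    have h0 := hv 0
    have h1 := hv 1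
    simp only [Matrix.cons_val] at h0 h1
    have hy : algebraMap F K y = 0 := by linear_combination h0
    rw [hy, mul_zero, add_zero, mul_eq_zero, or_iff_right (by simp [h2, hβ0])] at h1
    exact Prod.ext ((map_eq_zero _).1 h1) ((map_eq_zero _).1 hy)
  · exact fun l => injective_vec_three (hβF' l) (hβF l) hββ
  · intro l i
    fin_cases i
    · simp
    · have e : (![0, 1 / (2 * β), -1 / (2 * β)] : Fin 3 → K) 1 * algebraMap F K l +
          (![1, -1 / 2, -1 / 2] : Fin 3 → K) 1 * algebraMap F K 1 =
          (algebraMap F K l - β) / (2 * β) := by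
        simp only [Matrix.cons_val, map_one]
        field_simp
        ring
      exact e ▸ div_ne_zero (sub_ne_zero.2 (hβF l)) h2β
    · have e : (![0, 1 / (2 * β), -1 / (2 * β)] : Fin 3 → K) 2 * algebraMap F K l +
          (![1, -1 / 2, -1 / 2] : Fin 3 → K) 2 * algebraMap F K 1 =
          -(algebraMap F K l - -β) / (2 * β) := by
        simp only [Matrix.cons_val, map_one]
        field_simp
        ring
      exact e ▸ div_ne_zero (neg_ne_zero.2 (sub_ne_zero.2 (hβF' l))) h2β
  · intro l i
    simp only [map_neg, map_one, ← hβ]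
    fin_cases i
    · simp
    · simp only [Fin.mk_one, Matrix.cons_val]
      field_simp
      ring
    · simp only [Fin.reduceFinMk, Matrix.cons_val]
      field_simp
      ring
  · intro l l' a hal
    have e1 := congrArg Prod.fst hal
    have e2 := congrArg Prod.snd hal
    simp at e1 e2
    rw [e2, one_mul] at e1
    exact e1
  · rintro ⟨x, y⟩ hv
    have hy : y ≠ 0 := by
      have := hv 0
      simpa using this
    refine ⟨x / y, y, ?_⟩
    ext
    · simp [mul_div_cancel₀ _ hy]
    · simp

/-- The degenerate members are conjugate over the cubic extension of `F`. -/
theorem ncard_of_rotate [DecidableEq F] (h : IsFrame P u σ) (h2 : (2 : K) ≠ 0)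
    (hP : (P.basePoints K).ncard = 4)
    (hσ : ∀ a b, a ≠ b → splitting (σ a) (σ b) = splitting a b + 1) (n : ℕ) {α : Fin 3 → K}
    (hα : ∀ i, α i ^ Fintype.card F = α (i + 1)) (hα0 : ∀ a : F, algebraMap F K a ≠ α 0) :
    ((P.ponceletPairs K n).ncard : ℚ) = 1 / 2 *
      ((∑ l : {l : F // l ≠ 0},
        (torsionCount F n (cubic fun i => α i / (α i + algebraMap F K l)) : ℚ)) +
        (torsionCount F n (cubic fun i => (α i)⁻¹) : ℚ) + (torsionCount F n (cubic α) : ℚ)) := by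
  have hinjF : ∀ x y : K, x ^ Fintype.card F = y ^ Fintype.card F → x = y := fun x y hxy =>
    (FiniteField.frobeniusAlgHom F K).toRingHom.injective hxy
  have hαF : ∀ i, ∀ a : F, algebraMap F K a ≠ α i := by
    have step : ∀ i, (∀ a : F, algebraMap F K a ≠ α i) → ∀ a : F, algebraMap F K a ≠ α (i + 1) := by
      intro i hi a ha
      refine hi a (hinjF _ _ ?_)
      rw [hα, ← ha, ← map_pow, FiniteField.pow_card]
    have s1 := step 0 hα0
    have s2 := step 1 s1
    intro i
    fin_cases i
    · exact hα0
    · exact s1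
    · exact s2
  have hsucc : ∀ i, α i ≠ α (i + 1) := by
    intro i hi
    rw [← hα] at hi
    obtain ⟨a, ha⟩ := mem_range_of_pow_card_eq hi.symm
    exact hαF i a ha
  have hα01 : α 0 - α 1 ≠ 0 := sub_ne_zero.2 (hsucc 0)
  have hα12 : α 1 - α 2 ≠ 0 := sub_ne_zero.2 (hsucc 1)
  have hα20 : α 2 - α 0 ≠ 0 := sub_ne_zero.2 (hsucc 2)
  have hαinj : Function.Injective α := by
    intro i j hij
    by_contra hne
    have : j = i + 1 ∨ i = j + 1 := by
      clear hij
      revert i j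
      decide
    rcases this with rfl | rfl
    · exact hsucc _ hij
    · exact hsucc _ hij.symm
  -- Since `∑ νᵢ = ∑ νᵢ αᵢ = 0`, the forms `νᵢ (x - αᵢ y)` sum to zero, as split forms must, and
  -- Frobenius rotates them when `x`, `y` lie in `F`.
  let ν : Fin 3 → K := ![α 1 - α 2, α 2 - α 0, α 0 - α 1]
  have hν : ∀ i, ν i ≠ 0 := by
    intro i
    fin_cases i
    · exact hα12
    · exact hα20
    · exact hα01
  have hνf : ∀ i, ν i ^ Fintype.card F = ν (i + 1) := by
    intro i
    fin_cases i
    · exact (frob_sub _ _).trans (congrArg₂ _ (hα 1) (hα 2))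
    · exact (frob_sub _ _).trans (congrArg₂ _ (hα 2) (hα 0))
    · exact (frob_sub _ _).trans (congrArg₂ _ (hα 0) (hα 1))
  have hlin : ∀ (v : F × F) i, ν i * algebraMap F K v.1 + -(ν i * α i) * algebraMap F K v.2 =
      ν i * (algebraMap F K v.1 - α i * algebraMap F K v.2) := fun v i => by ring
  have hαl : ∀ i (l : F), α i + algebraMap F K l ≠ 0 := fun i l h0 =>
    hαF i (-l) (by rw [map_neg]; linear_combination -h0)
  have hαz : ∀ i, α i ≠ 0 := fun i h0 => hαF i 0 (by rw [map_zero, h0])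
  -- No degenerate member is rational, so charts run over the whole projective line: `none` stands
  -- for `∞`, `some none` for `0`.
  have main := h.ncard_ponceletPairs_of_coordinates h2 hP (α := ν) (β := fun i => -(ν i * α i))
    ?_ ?_ (Λ := Option (Option {l : F // l ≠ 0}))
    (fun l => match l with
      | none => (1, 0)
      | some none => (0, 1)
      | some (some l) => (-l, 1))
    (fun l => match l with
      | none => (0, 1)
      | some none => (1, 0)
      | some (some _) => (0, -1))
    (fun l => match l with
      | none => α
      | some none => fun i => (α i)⁻¹
      | some (some l) => fun i => α i / (α i + algebraMap F K l)) ?_ ?_ ?_ ?_ ?_ n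
  · rw [main, Fintype.sum_option, Fintype.sum_option]
    ring
  · intro M hM
    have hs := h.sum_splitForm h2 hM
    have f := h.splitForm_pow h2 (τ := (· + 1)) hσ hM
    set t : Fin 3 → K := fun i => splitForm u i M / ν i with ht
    have htL : ∀ i, splitForm u i M = ν i * t i := fun i => by
      rw [ht]
      field_simp [hν i]
    have htf : ∀ i, t i ^ Fintype.card F = t (i + 1) := fun i => by
      simp only [ht, div_pow, f, hνf]
    rw [htL, htL, htL] at hs
    simp only [ν, Matrix.cons_val] at hs
    -- The relation `∑ νᵢ tᵢ = 0` says that the points `(αᵢ, tᵢ)` lie on a line `t = x - yα`.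
    -- Frobenius permutes these points, so it fixes the slope `-y` and the intercept `x`.
    have hy₁ : (t 1 - t 0) / (α 0 - α 1) = (t 2 - t 1) / (α 1 - α 2) := by
      rw [div_eq_div_iff hα01 hα12]
      linear_combination -hs
    obtain ⟨y, hy⟩ := mem_range_of_pow_card_eq (F := F) (x := (t 1 - t 0) / (α 0 - α 1)) (by
      rw [div_pow, frob_sub, frob_sub, htf, htf, hα, hα, hy₁]
      rfl)
    have e01 : t 0 + α 0 * algebraMap F K y = t 1 + α 1 * algebraMap F K y := by
      rw [hy]
      field_simp
      ring
    have e12 : t 1 + α 1 * algebraMap F K y = t 2 + α 2 * algebraMap F K y := by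
      rw [hy, hy₁]
      field_simp
      ring
    obtain ⟨x, hx⟩ := mem_range_of_pow_card_eq (F := F) (x := t 0 + α 0 * algebraMap F K y) (by
      rw [frob_add, mul_pow, ← map_pow, FiniteField.pow_card, htf, hα]
      exact e01.symm)
    refine ⟨(x, y), fun i => ?_⟩
    rw [htL, hlin]
    congr 1
    simp only [hx]
    fin_cases i
    · simp
    · simp only [Fin.mk_one]
      linear_combination -e01
    · simp only [Fin.reduceFinMk]
      linear_combination -e01 - e12
  · rintro ⟨x, y⟩ hv
    have hv' : ∀ i, algebraMap F K x - α i * algebraMap F K y = 0 := fun i =>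
      (mul_eq_zero.1 ((hlin (x, y) i).symm.trans (hv i))).resolve_left (hν i)
    have hy : algebraMap F K y = 0 := by
      have : (α 0 - α 1) * algebraMap F K y = 0 := by linear_combination hv' 1 - hv' 0
      exact (mul_eq_zero.1 this).resolve_left hα01
    have hx := hv' 0
    rw [hy, mul_zero, sub_zero] at hx
    exact Prod.ext ((map_eq_zero _).1 hx) ((map_eq_zero _).1 hy)
  · rintro (_ | _ | ⟨l, hl⟩)
    · exact hαinj
    · exact inv_injective.comp hαinj
    · intro i j hij
      simp only at hij
      rw [div_eq_div_iff (hαl i l) (hαl j l)] at hij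
      have : algebraMap F K l * (α i - α j) = 0 := by linear_combination hij
      exact hαinj (sub_eq_zero.1 ((mul_eq_zero.1 this).resolve_left (by simpa using hl)))
  · rintro (_ | _ | ⟨l, hl⟩) i <;> rw [hlin] <;> refine mul_ne_zero (hν i) ?_
    · simp
    · simp [hαz]
    · simp only [map_neg, map_one]
      intro h0
      exact hαl i l (by linear_combination -h0)
  · rintro (_ | _ | ⟨l, hl⟩) i <;> rw [hlin, hlin]
    · simp
      ring
    · simp only [map_zero, map_one]
      field_simp [hαz i]
      ring
    · simp only [map_zero, map_one, map_neg]
      field_simp [hαl i l]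
      ring
  · rintro (_ | _ | ⟨l, hl⟩) (_ | _ | ⟨l', hl'⟩) a hal <;>
      have e1 := congrArg Prod.fst hal <;> have e2 := congrArg Prod.snd hal <;> simp at e1 e2 ⊢
    · exact hl' e1
    · simp [e2] at e1
    · rw [e2] at e1
      exact hl (e1.resolve_left one_ne_zero)
    · rw [e2, one_mul] at e1
      exact e1
  · rintro ⟨x, y⟩ -
    by_cases hy : y = 0
    · exact ⟨none, x, by simp [hy]⟩
    · by_cases hx : x = 0
      · exact ⟨some none, y, by simp [hx]⟩
      · refine ⟨some (some ⟨-(x / y), by simp [hx, hy]⟩), y, ?_⟩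
        ext
        · simp [mul_div_cancel₀ _ hy]
        · simp

end IsFrame
end Families

end Poncelet

end

/-! ### The main theorem. -/

open Poncelet Polynomial in
theorem mainTheorem8 {F : Type*} [Field F] [Fintype F] [DecidableEq F]
    {K : Type*} [Field K] [DecidableEq K] [Algebra F K] [IsAlgClosure F K]
    (hchar : ringChar F ≠ 2) (n : ℕ) (hn : 1 ≤ n) (P : Pencil F) :
    -- types (1,1,1,1) and (2,2): the Legendre family
    ((P.HasType K {1, 1, 1, 1} ∨ P.HasType K {2, 2}) →
      ((P.ponceletPairs K n).ncard : ℚ) =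
        1 / 2 * ∑ l : {l : F // l ≠ 0 ∧ l ≠ 1},
          (torsionCount F n (X * (X - 1) * (X - C (algebraMap F K l))) : ℚ)) ∧
    -- types (2,1,1) and (4)
    ((P.HasType K {2, 1, 1} ∨ P.HasType K {4}) →
      ∀ b : F, ¬ IsSquare b →
        ((P.ponceletPairs K n).ncard : ℚ) =
          1 / 2 * ∑ l : F,
            (torsionCount F n
              ((X - C (algebraMap F K l)) * (X ^ 2 - C (algebraMap F K b))) : ℚ)) ∧
    -- type (3,1), with the conjugates of `α` being `α ^ q ^ i`; the last two terms are the members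
    -- of the family at `0` and `∞`
    (P.HasType K {3, 1} →
      ∀ α : K, α ^ Fintype.card F ^ 3 = α → α ∉ Set.range (algebraMap F K) →
        ((P.ponceletPairs K n).ncard : ℚ) =
          1 / 2 *
            ((∑ l : {l : F // l ≠ 0},
                (torsionCount F n (∏ i : Fin 3,
                  (X - C (α ^ Fintype.card F ^ (i : ℕ) /
                    (α ^ Fintype.card F ^ (i : ℕ) + algebraMap F K l)))) : ℚ)) +
              (torsionCount F n (∏ i : Fin 3,
                (X - C (α ^ Fintype.card F ^ (i : ℕ))⁻¹)) : ℚ) +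
              (torsionCount F n (∏ i : Fin 3,
                (X - C (α ^ Fintype.card F ^ (i : ℕ)))) : ℚ))) := by
  have : IsAlgClosed K := IsAlgClosure.isAlgClosed F
  have h2 : (2 : K) ≠ 0 := by
    have : (2 : F) ≠ 0 := Ring.two_ne_zero hchar
    rw [← map_ofNat (algebraMap F K) 2]
    simpa using this
  have hcard : ∀ {p : Fin 4 → Plane K}, Function.Injective p → P.basePoints K = Set.range p →
      (P.basePoints K).ncard = 4 := by
    intro p hp hP
    rw [hP, ← Set.image_univ, Set.ncard_image_of_injective _ hp, Set.ncard_univ]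
    simp
  refine ⟨fun h => ?_, fun h b hb => ?_, fun h α hα hαF => ?_⟩
  · obtain ⟨p, σ, hp, hP, hfr, hσ⟩ : ∃ (p : Fin 4 → Plane K) (σ : Equiv.Perm (Fin 4)),
        Function.Injective p ∧ P.basePoints K = Set.range p ∧
        (∀ i, frobPoint F (p i) = p (σ i)) ∧
        (σ.partition.parts = {1, 1, 1, 1} ∨ σ.partition.parts = {2, 2}) := by
      rcases h with ⟨p, σ, hp, hP, hfr, hσ⟩ | ⟨p, σ, hp, hP, hfr, hσ⟩
      · exact ⟨p, σ, hp, hP, hfr, Or.inl hσ⟩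
      · exact ⟨p, σ, hp, hP, hfr, Or.inr hσ⟩
    obtain ⟨u, hu⟩ := exists_isFrame h2 hp hP hfr
    have hf : ∀ l : {l : F // l ≠ 0 ∧ l ≠ 1}, cubic ![0, algebraMap F K l, 1] =
        X * (X - 1) * (X - C (algebraMap F K l)) := by
      intro l
      simp only [cubic, Fin.prod_univ_three, Matrix.cons_val, map_zero, map_one]
      ring
    simpa only [hf] using
      hu.ncard_of_trivial h2 (hcard hp hP) (splitting_of_trivial hσ) n
  · obtain ⟨p, σ, hp, hP, hfr, hσ⟩ : ∃ (p : Fin 4 → Plane K) (σ : Equiv.Perm (Fin 4)),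
        Function.Injective p ∧ P.basePoints K = Set.range p ∧
        (∀ i, frobPoint F (p i) = p (σ i)) ∧
        (σ.partition.parts = {2, 1, 1} ∨ σ.partition.parts = {4}) := by
      rcases h with ⟨p, σ, hp, hP, hfr, hσ⟩ | ⟨p, σ, hp, hP, hfr, hσ⟩
      · exact ⟨p, σ, hp, hP, hfr, Or.inl hσ⟩
      · exact ⟨p, σ, hp, hP, hfr, Or.inr hσ⟩
    obtain ⟨u, hu⟩ := exists_isFrame h2 hp hP hfr
    obtain ⟨π, hπ⟩ := splitting_of_odd hσ
    obtain ⟨β, hβ⟩ := IsAlgClosed.exists_pow_nat_eq (algebraMap F K b) two_pos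
    have hf : ∀ l : F, cubic ![algebraMap F K l, -β, β] =
        (X - C (algebraMap F K l)) * (X ^ 2 - C (algebraMap F K b)) := by
      intro l
      simp only [cubic, Fin.prod_univ_three, Matrix.cons_val, map_neg, ← hβ, map_pow]
      ring
    simpa only [hf] using (hu.relabel π).ncard_of_swap h2 (hcard hp hP) hπ n hb hβ
  · obtain ⟨p, σ, hp, hP, hfr, hσ⟩ := h
    obtain ⟨u, hu⟩ := exists_isFrame h2 hp hP hfr
    obtain ⟨π, hπ⟩ := splitting_of_threeCycle hσ
    -- Addition in `Fin 3` wraps around at `2`, where `α ^ q ^ 3 = α` closes the cycle of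
    -- conjugates.
    have hi : ∀ i : Fin 3, ((i + 1 : Fin 3) : ℕ) = i + 1 ∨
        (i : ℕ) = 2 ∧ ((i + 1 : Fin 3) : ℕ) = 0 := by decide
    have hrot : ∀ i : Fin 3, (α ^ Fintype.card F ^ (i : ℕ)) ^ Fintype.card F =
        α ^ Fintype.card F ^ ((i + 1 : Fin 3) : ℕ) := by
      intro i
      rw [← pow_mul, ← pow_succ]
      rcases hi i with hi | ⟨hi, hi'⟩
      · rw [hi]
      · rw [hi, hi', pow_zero, pow_one, hα]
    have h0 : ∀ a : F, algebraMap F K a ≠ α ^ Fintype.card F ^ ((0 : Fin 3) : ℕ) := by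
      intro a ha
      rw [Fin.val_zero, pow_zero, pow_one] at ha
      exact hαF ⟨a, ha⟩
    have main := (hu.relabel π).ncard_of_rotate h2 (hcard hp hP) hπ n
      (α := fun i => α ^ Fintype.card F ^ (i : ℕ)) hrot h0
    simp only [cubic] at main
    exact main
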